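/- **Syntax.** Fix a first-order language $L$ (relation symbols, function symbols, constants; no equality) and a family of event frames, i.e. Kripke frames $(E,R_E)$ in which every event $e$ has only finitely many successors $e'$ ($e\,R_E\,e'$). Formulas in context $(\bar x\mid\varphi)$ are built from $\top$ and atomic formulas by $\neg,\wedge,\forall,\Box$ and the dynamic operators $[E,e]$, where $E$ consists of an event frame of the family together with a precondition $\mathrm{Pre}(e)$ for each event $e$, which is a closed sentence of the same language; the other connectives, $\exists$, $\Diamond$ and $\langle E,e\rangle$ are defined as usual. Substitution commutes with $\Box$ and $[E,e]$. **Semantics.** A Kripke sheaf is a bounded morphism of Kripke frames $\pi:(D,R_D)\to(X,R_X)$ such that $a R_D b$, $a R_D b'$ and $\pi(b)=\pi(b')$ imply $b=b'$. For $n\ge 0$ let $D^n_X$ be the set of $n$-tuples of elements of the same fibre of $\pi$ (with $D^0_X=X$), with the relation $R_{D^n_X}$ that holds componentwise (and is $R_X$ for $n=0$). A Kripke-sheaf model is a surjective Kripke sheaf $\pi$ with a monotone map $[\![f]\!]:D^n_X\to D$ over $X$ for every $n$-ary function symbol $f$ and a subset $[\![F]\!]\subseteq D^n_X$ for every $n$-ary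 relation symbol $F$. A formula in an $n$-variable context is interpreted as a subset $[\![\bar x\mid\varphi]\!]_\pi\subseteq D^n_X$: the first-order connectives are interpreted fibrewise, $\bar a\in[\![\bar x\mid\Box\varphi]\!]_\pi$ iff $\bar b\in[\![\bar x\mid\varphi]\!]_\pi$ for all $\bar b$ with $\bar a R_{D^n_X}\bar b$, and $\bar a\in[\![\bar x\mid[E,e]\varphi]\!]_\pi$ iff $\pi^n(\bar a)\notin[\![\mathrm{Pre}(e)]\!]_\pi$ or $(\bar a,e)\in[\![\bar x\mid\varphi]\!]_{\pi_{X\otimes E}}$. Here $\pi^n(\bar a)$ is the world of $\bar a$ and $\pi_{X\otimes E}$ is the pullback update of the model: its worlds are the pairs $(w,e)$ with $w\in[\![\mathrm{Pre}(e)]\!]_\pi$, its individuals the pairs $(a,e)$ with $\pi(a)\in[\![\mathrm{Pre}(e)]\!]_\pi$, its residence map is $(a,e)\mapsto(\pi(a),e)$, both relations hold componentwise (with $R_E$ in the second component), and function and relation symbols are interpreted by $(\bar a,e)\mapsto([\![f]\!](\bar a),e)$ and $\{(\bar a,e)\mid\bar a\in[\![F]\!]\}$. A formula in context is valid in a model if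 it holds of all tuples in $D^n_X$. **Logic.** $\mathsf{FODEL\text{-}K}$ consists of classical first-order logic; the axiom and rule of the modal logic $\mathsf K$ (distribution and necessitation) for $\Box$ and for each modal operator $[E,e]$; the reduction axioms $$[E,e]p\leftrightarrow(\mathrm{Pre}(e)\to p)\ (p\text{ atomic}),\quad [E,e]\neg\varphi\leftrightarrow(\mathrm{Pre}(e)\to\neg[E,e]\varphi),\quad [E,e]\top\leftrightarrow\top,$$ $$[E,e](\varphi\wedge\psi)\leftrightarrow([E,e]\varphi\wedge[E,e]\psi),\quad [E,e]\Box\varphi\leftrightarrow\Bigl(\mathrm{Pre}(e)\to\Box\bigwedge_{e R_E e'}[E,e']\varphi\Bigr);$$ and the quantifier reduction axiom $[E,e]\forall y.\varphi\leftrightarrow\forall y.[E,e]\varphi$. $\mathsf{FODEL\text{-}S4}$ adds $\Box\varphi\to\varphi$ and $\Box\varphi\to\Box\Box\varphi$, and $\mathsf{FODEL\text{-}S5}$ adds moreover $\neg\Box\varphi\to\Box\neg\Box\varphi$. **Theorem.** $\mathsf{FODEL\text{-}K}$ is sound and complete with respect to Kripke-sheaf models with pullback updates: a formula in context is provable in $\mathsf{FODEL\text{-}K}$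 if and only if it is valid in all Kripke-sheaf models. If all event frames of the family are preorders (respectively, equivalence relations), then likewise a formula in context is provable in $\mathsf{FODEL\text{-}S4}$ (respectively, $\mathsf{FODEL\text{-}S5}$) if and only if it is valid in all Kripke-sheaf models in which $R_X$ and $R_D$ are both preorders (respectively, both equivalence relations). -/

import Mathlib

universe u v s w

namespace FODEL

/-! ### Kripke frames, bounded morphisms, Kripke sheaves -/

/-- A Kripke frame: a set with a binary relation. -/
structure KripkeFrame where
  carrier : Type w
  rel : carrier → carrier → Prop

instance : CoeSort KripkeFrame.{w} (Type w) := ⟨KripkeFrame.carrier⟩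

/-- A monotone map of Kripke frames. -/
def IsMonotone {X Y : KripkeFrame.{w}} (f : X → Y) : Prop :=
  ∀ a b : X, X.rel a b → Y.rel (f a) (f b)

/-- A bounded morphism of Kripke frames. -/
structure IsBoundedMorphism {X Y : KripkeFrame.{w}} (f : X → Y) : Prop where
  mono : IsMonotone f
  back : ∀ (a : X) (y : Y), Y.rel (f a) y → ∃ b : X, X.rel a b ∧ f b = y

/-- A Kripke sheaf: a bounded morphism `π : D → X` such that an individual has at most one
successor in each world. -/
structure IsKripkeSheaf {D X : KripkeFrame.{w}} (π : D → X) : Prop where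
  bounded : IsBoundedMorphism π
  unique : ∀ a b b' : D, D.rel a b → D.rel a b' → π b = π b' → b = b'

/-- The `n`-fold fibered power `Dⁿ_X` of `π : D → X`: a world together with `n` individuals living
in it (so `D⁰_X` is `X`). Its relation is the initial lift of the projections to `X` and to `D`,
which makes it the `n`-fold product of `π` in the slice category of Kripke frames over `X`. -/
def fiberedPower {D X : KripkeFrame.{w}} (π : D → X) (n : ℕ) : KripkeFrame.{w} where
  carrier := { p : X × (Fin n → D) // ∀ i, π (p.2 i) = p.1 }
  rel p q := X.rel p.1.1 q.1.1 ∧ ∀ i, D.rel (p.1.2 i) (q.1.2 i)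

/-! ### Kripke-sheaf models -/

/-- A Kripke-sheaf model for a first-order language `L`: a surjective Kripke sheaf `res : D → X`
(the residence map), for each `n`-ary function symbol a monotone map `Dⁿ_X → D` over `X`, and for
each `n`-ary relation symbol a subset of `Dⁿ_X`. -/
structure KripkeSheafModel (L : FirstOrder.Language.{u, v}) where
  worlds : KripkeFrame.{w}
  indiv : KripkeFrame.{w}
  res : indiv → worlds
  sheaf : IsKripkeSheaf res
  surj : Function.Surjective res
  funMap : ∀ {n : ℕ}, L.Functions n → fiberedPower res n → indiv
  funMap_over : ∀ {n : ℕ} (f : L.Functions n) (p : fiberedPower res n),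
    res (funMap f p) = p.1.1
  funMap_mono : ∀ {n : ℕ} (f : L.Functions n), IsMonotone (funMap f)
  relMap : ∀ {n : ℕ}, L.Relations n → Set (fiberedPower res n)

namespace KripkeSheafModel

variable {L : FirstOrder.Language.{u, v}}

/-- The Kripke frame `Dⁿ_X` of `n`-tuples of individuals from the same world. -/
abbrev tuples (M : KripkeSheafModel.{u, v, w} L) (n : ℕ) : KripkeFrame.{w} :=
  fiberedPower M.res n

/-- The interpretation of a term in context, as a map `Dⁿ_X → D` over `X`. -/
def termVal (M : KripkeSheafModel.{u, v, w} L) {n : ℕ} (p : M.tuples n) :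
    L.Term (Fin n) → { d : M.indiv // M.res d = p.1.1 }
  | .var i => ⟨p.1.2 i, p.2 i⟩
  | .func f ts =>
      ⟨M.funMap f ⟨(p.1.1, fun j => (termVal M p (ts j)).1), fun j => (termVal M p (ts j)).2⟩,
        M.funMap_over f _⟩

/-- The tuple of values of a tuple of terms in context, as a map `Dᵐ_X → Dⁿ_X` over `X`. -/
def termsVal (M : KripkeSheafModel.{u, v, w} L) {m n : ℕ} (ts : Fin n → L.Term (Fin m))
    (p : M.tuples m) : M.tuples n :=
  ⟨(p.1.1, fun j => (M.termVal p (ts j)).1), fun j => (M.termVal p (ts j)).2⟩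

/-- A world, as an element of `D⁰_X`. -/
def ofWorld (M : KripkeSheafModel.{u, v, w} L) (x : M.worlds) : M.tuples 0 :=
  ⟨(x, Fin.elim0), fun i => i.elim0⟩

/-- The tuple `(a₁, …, aₙ, d)`, for `d` living in the same world as `a₁, …, aₙ`. -/
def extend (M : KripkeSheafModel.{u, v, w} L) {n : ℕ} (p : M.tuples n) (d : M.indiv)
    (hd : M.res d = p.1.1) : M.tuples (n + 1) :=
  ⟨(p.1.1, Fin.snoc (α := fun _ => M.indiv.carrier) p.1.2 d), fun i => by
    refine Fin.lastCases ?_ (fun j => ?_) i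
    · simpa using hd
    · simpa using p.2 j⟩

section Update

variable (M : KripkeSheafModel.{u, v, w} L) (E : KripkeFrame.{0}) (pre : E → Set M.worlds)

/-- The product update `X ⊗ E` of the worlds, where `pre e` is the extension of the precondition
of the event `e`. -/
def updWorlds : KripkeFrame.{w} where
  carrier := { p : M.worlds × E // p.1 ∈ pre p.2 }
  rel p q := M.worlds.rel p.1.1 q.1.1 ∧ E.rel p.1.2 q.1.2

/-- The domain `D_{X ⊗ E}` of the pullback of the residence map along `X ⊗ E → X`. -/
def updIndiv : KripkeFrame.{w} where
  carrier := { p : M.indiv × E // M.res p.1 ∈ pre p.2 }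
  rel p q := M.indiv.rel p.1.1 q.1.1 ∧ E.rel p.1.2 q.1.2

/-- The updated residence map `(a, e) ↦ (π a, e)`. -/
def updRes (p : M.updIndiv E pre) : M.updWorlds E pre :=
  ⟨(M.res p.1.1, p.1.2), p.2⟩

/-- The projection `Dⁿ_{X ⊗ E} → Dⁿ_X`. -/
def updProj {n : ℕ} (p : fiberedPower (M.updRes E pre) n) : M.tuples n :=
  ⟨(p.1.1.1.1, fun i => (p.1.2 i).1.1), fun i =>
    congrArg (fun x : M.updWorlds E pre => x.1.1) (p.2 i)⟩

/-- The pullback update of a Kripke-sheaf model along `X ⊗ E → X`. -/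
def update : KripkeSheafModel.{u, v, w} L where
  worlds := M.updWorlds E pre
  indiv := M.updIndiv E pre
  res := M.updRes E pre
  sheaf :=
    { bounded :=
        { mono := fun _ _ h => ⟨M.sheaf.bounded.mono _ _ h.1, h.2⟩
          back := by
            rintro ⟨⟨a, e⟩, ha⟩ ⟨⟨y, e'⟩, hy⟩ ⟨h1, h2⟩
            obtain ⟨b, hb, rfl⟩ := M.sheaf.bounded.back a y h1
            exact ⟨⟨(b, e'), hy⟩, ⟨hb, h2⟩, rfl⟩ }
      unique := by
        rintro ⟨⟨a, e⟩, ha⟩ ⟨⟨b, e₁⟩, hb⟩ ⟨⟨c, e₂⟩, hc⟩ ⟨h1, _⟩ ⟨h2, _⟩ h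
        have h' := congrArg Subtype.val h
        obtain ⟨h3, h4⟩ := Prod.mk.inj h'
        obtain rfl := M.sheaf.unique a b c h1 h2 h3
        obtain rfl : e₁ = e₂ := h4
        rfl }
  surj := by
    rintro ⟨⟨x, e⟩, hx⟩
    obtain ⟨d, rfl⟩ := M.surj x
    exact ⟨⟨(d, e), hx⟩, rfl⟩
  funMap := fun f p =>
    ⟨(M.funMap f (M.updProj E pre p), p.1.1.1.2), by
      rw [M.funMap_over]; exact p.1.1.2⟩
  funMap_over := fun f p => Subtype.ext (Prod.ext (M.funMap_over f _) rfl)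
  funMap_mono := fun f _ _ h =>
    ⟨M.funMap_mono f _ _ ⟨h.1.1, fun i => (h.2 i).1⟩, h.1.2⟩
  relMap := fun F => { p | M.updProj E pre p ∈ M.relMap F }

/-- The injection `ā ↦ (ā, e)` from the extension of the precondition of `e` in `Dⁿ_X`
to `Dⁿ_{X ⊗ E}`. -/
def inject {n : ℕ} (e : E) (p : M.tuples n) (h : p.1.1 ∈ pre e) :
    (M.update E pre).tuples n :=
  ⟨(⟨(p.1.1, e), h⟩, fun i => ⟨(p.1.2 i, e), by
      have hi := p.2 i
      change M.res (p.1.2 i) ∈ pre e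
      rw [hi]; exact h⟩),
    fun i => Subtype.ext (Prod.ext (p.2 i) rfl)⟩

end Update

end KripkeSheafModel

/-! ### Formulas in context -/

/-- A family of event frames, from which the dynamic operators `[E, e]` of a language are formed.
Each event has finitely many successors, so that the conjunction over all successors of an event
is a formula. -/
structure EventFrames where
  ι : Type s
  frame : ι → KripkeFrame.{0}
  finite_succ : ∀ (i : ι) (e : frame i), { e' | (frame i).rel e e' }.Finite

/-- `Formula L 𝓔 n` is the type of formulas of first-order dynamic epistemic logic in the context
`(x₀, …, xₙ₋₁)`. A quantifier binds the last variable of the context. In `dyn i pre e φ`, read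
`[E, e] φ`, the event model `E` consists of the event frame `𝓔.frame i` and the closed sentences
`pre e'` as preconditions. -/
inductive Formula (L : FirstOrder.Language.{u, v}) (𝓔 : EventFrames.{s}) : ℕ → Type (max u v s)
  | top {n : ℕ} : Formula L 𝓔 n
  | rel {n k : ℕ} (F : L.Relations k) (ts : Fin k → L.Term (Fin n)) : Formula L 𝓔 n
  | neg {n : ℕ} (φ : Formula L 𝓔 n) : Formula L 𝓔 n
  | and {n : ℕ} (φ ψ : Formula L 𝓔 n) : Formula L 𝓔 n
  | all {n : ℕ} (φ : Formula L 𝓔 (n + 1)) : Formula L 𝓔 n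
  | box {n : ℕ} (φ : Formula L 𝓔 n) : Formula L 𝓔 n
  | dyn {n : ℕ} (i : 𝓔.ι) (pre : 𝓔.frame i → Formula L 𝓔 0) (e : 𝓔.frame i)
      (φ : Formula L 𝓔 n) : Formula L 𝓔 n

namespace Formula

variable {L : FirstOrder.Language.{u, v}} {𝓔 : EventFrames.{s}}

/-- Implication. -/
def imp {n : ℕ} (φ ψ : Formula L 𝓔 n) : Formula L 𝓔 n := neg (and φ (neg ψ))

/-- Equivalence. -/
def iff {n : ℕ} (φ ψ : Formula L 𝓔 n) : Formula L 𝓔 n := and (imp φ ψ) (imp ψ φ)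

/-- Finite conjunction. -/
def conj {n : ℕ} (l : List (Formula L 𝓔 n)) : Formula L 𝓔 n := l.foldr and top

/-- The substitution `x₀, …, xₙ ↦ σ x₀, …, σ xₙ₋₁, x_m` used under a quantifier. -/
def liftSubst {m n : ℕ} (σ : Fin n → L.Term (Fin m)) : Fin (n + 1) → L.Term (Fin (m + 1)) :=
  Fin.snoc (α := fun _ => L.Term (Fin (m + 1)))
    (fun i => (σ i).relabel Fin.castSucc) (FirstOrder.Language.Term.var (Fin.last m))

/-- Capture-avoiding simultaneous substitution `φ[σ x₀, …, σ xₙ₋₁ / x₀, …, xₙ₋₁]`. It commutes with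
`□` and with `[E, e]`, whose preconditions are closed. -/
def subst : {n : ℕ} → Formula L 𝓔 n → {m : ℕ} → (Fin n → L.Term (Fin m)) → Formula L 𝓔 m
  | _, top, _, _ => top
  | _, rel F ts, _, σ => rel F (fun j => (ts j).subst σ)
  | _, neg φ, _, σ => neg (φ.subst σ)
  | _, and φ ψ, _, σ => and (φ.subst σ) (ψ.subst σ)
  | _, all φ, _, σ => all (φ.subst (liftSubst σ))
  | _, box φ, _, σ => box (φ.subst σ)
  | _, dyn i pre e φ, _, σ => dyn i pre e (φ.subst σ)

/-- The formula `φ` in the context with one more (vacuous) variable. -/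
def weaken {n : ℕ} (φ : Formula L 𝓔 n) : Formula L 𝓔 (n + 1) :=
  φ.subst fun i => FirstOrder.Language.Term.var i.castSucc

/-- The substitution of `t` for the last variable of the context. -/
def inst {n : ℕ} (φ : Formula L 𝓔 (n + 1)) (t : L.Term (Fin n)) : Formula L 𝓔 n :=
  φ.subst (Fin.snoc (α := fun _ => L.Term (Fin n)) (fun i => FirstOrder.Language.Term.var i) t)

/-- A closed sentence, in the context `(x₀, …, xₙ₋₁)`. -/
def ofSentence {n : ℕ} (φ : Formula L 𝓔 0) : Formula L 𝓔 n :=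
  φ.subst fun i => i.elim0

/-- The formula `⋀ [E, e'] φ`, with `e'` ranging over all successors of `e`. -/
noncomputable def conjSucc {n : ℕ} (i : 𝓔.ι) (pre : 𝓔.frame i → Formula L 𝓔 0)
    (e : 𝓔.frame i) (φ : Formula L 𝓔 n) : Formula L 𝓔 n :=
  conj ((𝓔.finite_succ i e).toFinset.toList.map fun e' => dyn i pre e' φ)

/-- Substitution instances of classical propositional tautologies: formulas that are true under
every assignment of truth values to formulas which respects `⊤`, `¬` and `∧`. -/
def IsTautology {n : ℕ} (φ : Formula L 𝓔 n) : Prop :=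
  ∀ V : Formula L 𝓔 n → Prop, V top → (∀ ψ, V (neg ψ) ↔ ¬ V ψ) →
    (∀ ψ χ, V (and ψ χ) ↔ V ψ ∧ V χ) → V φ

/-- Truth of a formula in context at a tuple: `φ.sat M p` says `p ∈ ⟦x̄ ∣ φ⟧`. In the clause for
`[E, e] φ`, the formula `φ` is evaluated in the pullback update of `M`. -/
def sat : {n : ℕ} → Formula L 𝓔 n → (M : KripkeSheafModel.{u, v, w} L) → M.tuples n → Prop
  | _, top, _, _ => True
  | _, rel F ts, M, p => M.termsVal ts p ∈ M.relMap F
  | _, neg φ, M, p => ¬ φ.sat M p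
  | _, and φ ψ, M, p => φ.sat M p ∧ ψ.sat M p
  | _, all φ, M, p => ∀ (d : M.indiv) (hd : M.res d = p.1.1), φ.sat M (M.extend p d hd)
  | n, box φ, M, p => ∀ q : M.tuples n, (M.tuples n).rel p q → φ.sat M q
  | _, dyn i pre e φ, M, p =>
      ∀ h : (pre e).sat M (M.ofWorld p.1.1),
        φ.sat (M.update (𝓔.frame i) fun e' => { x | (pre e').sat M (M.ofWorld x) })
          (M.inject (𝓔.frame i) (fun e' => { x | (pre e').sat M (M.ofWorld x) }) e p h)

end Formula

/-! ### The logics -/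

/-- The propositional modal logics on which the first-order logics are based. -/
inductive BaseLogic
  | K
  | S4
  | S5

/-- The frame condition of a base logic: none for `K`, preorders for `S4`, equivalence relations
for `S5`. -/
def BaseLogic.FrameCondition : BaseLogic → KripkeFrame.{w} → Prop
  | .K, _ => True
  | .S4, X => (∀ x, X.rel x x) ∧ ∀ x y z, X.rel x y → X.rel y z → X.rel x z
  | .S5, X => Equivalence X.rel

/-- The modal axioms that a base logic adds to `K`: `□φ → φ` and `□φ → □□φ` for `S4` and `S5`, and
`¬□φ → □¬□φ` for `S5`. -/
inductive BaseLogic.Axiom {L : FirstOrder.Language.{u, v}} {𝓔 : EventFrames.{s}} {n : ℕ} :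
    BaseLogic → Formula L 𝓔 n → Prop
  | refl_S4 (φ : Formula L 𝓔 n) : Axiom .S4 (φ.box.imp φ)
  | trans_S4 (φ : Formula L 𝓔 n) : Axiom .S4 (φ.box.imp φ.box.box)
  | refl_S5 (φ : Formula L 𝓔 n) : Axiom .S5 (φ.box.imp φ)
  | trans_S5 (φ : Formula L 𝓔 n) : Axiom .S5 (φ.box.imp φ.box.box)
  | eucl_S5 (φ : Formula L 𝓔 n) : Axiom .S5 (φ.box.neg.imp φ.box.neg.box)

open Formula in
/-- Provability, in a context, in the first-order dynamic epistemic logic over a base logic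
(`FODEL-K`, `FODEL-S4`, `FODEL-S5`): classical first-order logic, the base logic for `□`, the axiom
and rule of normal modal logic for the modal operators `[E, e]`, the reduction axioms of
propositional dynamic epistemic logic, and the reduction axiom for the quantifier. -/
inductive Provable {L : FirstOrder.Language.{u, v}} {𝓔 : EventFrames.{s}} (S : BaseLogic) :
    {n : ℕ} → Formula L 𝓔 n → Prop
  -- classical first-order logic
  | taut {n : ℕ} {φ : Formula L 𝓔 n} (h : φ.IsTautology) : Provable S φ
  | mp {n : ℕ} {φ ψ : Formula L 𝓔 n} (h₁ : Provable S (imp φ ψ)) (h₂ : Provable S φ) :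
      Provable S ψ
  | all_inst {n : ℕ} (φ : Formula L 𝓔 (n + 1)) (t : L.Term (Fin n)) :
      Provable S (imp (all φ) (φ.inst t))
  | all_dist {n : ℕ} (φ ψ : Formula L 𝓔 (n + 1)) :
      Provable S (imp (all (imp φ ψ)) (imp (all φ) (all ψ)))
  | all_vacuous {n : ℕ} (φ : Formula L 𝓔 n) : Provable S (iff (all φ.weaken) φ)
  | gen {n : ℕ} {φ : Formula L 𝓔 (n + 1)} (h : Provable S φ) : Provable S (all φ)
  -- propositional modal logic
  | box_dist {n : ℕ} (φ ψ : Formula L 𝓔 n) :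
      Provable S (imp (box (imp φ ψ)) (imp (box φ) (box ψ)))
  | box_nec {n : ℕ} {φ : Formula L 𝓔 n} (h : Provable S φ) : Provable S (box φ)
  | base {n : ℕ} {φ : Formula L 𝓔 n} (h : S.Axiom φ) : Provable S φ
  | dyn_dist {n : ℕ} (i : 𝓔.ι) (pre : 𝓔.frame i → Formula L 𝓔 0) (e : 𝓔.frame i)
      (φ ψ : Formula L 𝓔 n) :
      Provable S (imp (dyn i pre e (imp φ ψ)) (imp (dyn i pre e φ) (dyn i pre e ψ)))
  | dyn_nec {n : ℕ} (i : 𝓔.ι) (pre : 𝓔.frame i → Formula L 𝓔 0) (e : 𝓔.frame i)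
      {φ : Formula L 𝓔 n} (h : Provable S φ) : Provable S (dyn i pre e φ)
  -- reduction axioms
  | red_rel {n k : ℕ} (i : 𝓔.ι) (pre : 𝓔.frame i → Formula L 𝓔 0) (e : 𝓔.frame i)
      (F : L.Relations k) (ts : Fin k → L.Term (Fin n)) :
      Provable S (iff (dyn i pre e (rel F ts)) (imp (ofSentence (pre e)) (rel F ts)))
  | red_neg {n : ℕ} (i : 𝓔.ι) (pre : 𝓔.frame i → Formula L 𝓔 0) (e : 𝓔.frame i)
      (φ : Formula L 𝓔 n) :
      Provable S (iff (dyn i pre e (neg φ)) (imp (ofSentence (pre e)) (neg (dyn i pre e φ))))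
  | red_top {n : ℕ} (i : 𝓔.ι) (pre : 𝓔.frame i → Formula L 𝓔 0) (e : 𝓔.frame i) :
      Provable S (iff (dyn i pre e (top : Formula L 𝓔 n)) top)
  | red_and {n : ℕ} (i : 𝓔.ι) (pre : 𝓔.frame i → Formula L 𝓔 0) (e : 𝓔.frame i)
      (φ ψ : Formula L 𝓔 n) :
      Provable S (iff (dyn i pre e (and φ ψ)) (and (dyn i pre e φ) (dyn i pre e ψ)))
  | red_box {n : ℕ} (i : 𝓔.ι) (pre : 𝓔.frame i → Formula L 𝓔 0) (e : 𝓔.frame i)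
      (φ : Formula L 𝓔 n) :
      Provable S (iff (dyn i pre e (box φ)) (imp (ofSentence (pre e)) (box (conjSucc i pre e φ))))
  | red_all {n : ℕ} (i : 𝓔.ι) (pre : 𝓔.frame i → Formula L 𝓔 0) (e : 𝓔.frame i)
      (φ : Formula L 𝓔 (n + 1)) :
      Provable S (iff (dyn i pre e (all φ)) (all (dyn i pre e φ)))

/-- Validity of a formula in context in all Kripke-sheaf models of the class that corresponds to
the base logic: all models for `K`, and for `S4` or `S5` those whose residence map is a Kripke sheaf
in the category of preorders or of equivalence relations. -/
def Valid {L : FirstOrder.Language.{u, v}} {𝓔 : EventFrames.{s}} (S : BaseLogic) {n : ℕ}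
    (φ : Formula L 𝓔 n) : Prop :=
  ∀ M : KripkeSheafModel.{u, v, w} L, S.FrameCondition M.worlds → S.FrameCondition M.indiv →
    ∀ p : M.tuples n, φ.sat M p

end FODEL

-- Soundness is an induction on derivations, over all models at once because `[E, e]` moves to the
-- updated model. Its semantic core is the substitution lemma `sat_subst`. The `□` case of that
-- lemma is where the sheaf condition enters: a tuple has exactly one successor tuple in each
-- successor world, so evaluating terms commutes with passing to successors. Nonempty fibres
-- validate the vacuous quantifier axiom. The quantifier reduction axiom holds because the
-- individuals over `(w, e)` are those over `w`.
--
-- For completeness, the reduction axioms eliminate the dynamic operators: every formula is provably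
-- equivalent to a static one (`provable_subst_iff_reduce`). By soundness, a formula and its static
-- form are true at the same tuples, so it suffices to refute unprovable static formulas. Static
-- formulas have variables in `ℕ`, which keeps fresh variables available. Only the countably many
-- symbols of the given formula are kept, but "theorem" still means provable in the full language
-- (`derivable`), so no conservativity result is needed.
--
-- Worlds of the canonical model are complete theories with the Henkin property, and individuals are
-- terms. A theory closed under the rule "all variable instances, hence `∀`" extends to a world
-- avoiding any given non-member, by a Rasiowa-Sikorski argument (`exists_isWorld`). For `K` and
-- `S4`, successors are found after renaming variables by doubling, so that odd variables are fresh.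
-- Each world carries a level, and the renaming from level `k` to level `l` is multiplication by `2
-- ^ (l - k)`. It depends only on the two worlds, which gives the sheaf condition, and it composes,
-- which gives transitivity. For `S5`, the Barcan formula is derivable, so successors keep the same
-- variables and the identity renaming makes the relations symmetric.

universe u' v'

namespace FODEL

open FirstOrder

/-! ### Soundness -/

namespace KripkeSheafModel

variable {L : FirstOrder.Language.{u, v}} (M : KripkeSheafModel.{u, v, w} L)

theorem tuple_ext {n : ℕ} {p q : M.tuples n} (h : p.1.1 = q.1.1) (h' : ∀ i, p.1.2 i = q.1.2 i) :
    p = q :=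
  Subtype.ext (Prod.ext h (funext h'))

theorem termVal_subst {m n : ℕ} (p : M.tuples m) (σ : Fin n → L.Term (Fin m))
    (t : L.Term (Fin n)) :
    (M.termVal p (t.subst σ)).1 = (M.termVal (M.termsVal σ p) t).1 := by
  induction t with
  | var i => rfl
  | func f ts ih =>
    simp only [Language.Term.subst, termVal]
    congr 1
    exact M.tuple_ext rfl ih

theorem termsVal_subst {k m n : ℕ} (p : M.tuples m) (σ : Fin n → L.Term (Fin m))
    (ts : Fin k → L.Term (Fin n)) :
    M.termsVal (fun j => (ts j).subst σ) p = M.termsVal ts (M.termsVal σ p) :=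
  M.tuple_ext rfl fun j => M.termVal_subst p σ (ts j)

theorem termVal_relabel {m n : ℕ} (p : M.tuples m) (g : Fin n → Fin m) (t : L.Term (Fin n)) :
    (M.termVal p (t.relabel g)).1 =
      (M.termVal (M.termsVal (fun i => Language.Term.var (g i)) p) t).1 := by
  induction t with
  | var i => rfl
  | func f ts ih =>
    simp only [Language.Term.relabel, termVal]
    congr 1
    exact M.tuple_ext rfl ih

theorem termsVal_var_castSucc_extend {n : ℕ} (p : M.tuples n) (d : M.indiv)
    (hd : M.res d = p.1.1) :
    M.termsVal (fun i => Language.Term.var i.castSucc) (M.extend p d hd) = p :=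
  M.tuple_ext rfl fun i => by simp [termsVal, termVal, extend]

theorem termsVal_snoc_var {n : ℕ} (p : M.tuples n) (t : L.Term (Fin n)) :
    M.termsVal (Fin.snoc (α := fun _ => L.Term (Fin n)) (fun i => Language.Term.var i) t) p =
      M.extend p (M.termVal p t).1 (M.termVal p t).2 :=
  M.tuple_ext rfl fun i => by
    refine Fin.lastCases ?_ (fun j => ?_) i
    · simp [termsVal, extend]
    · simp [termsVal, extend, termVal]

theorem termVal_relabel_castSucc_extend {n : ℕ} (p : M.tuples n) (d : M.indiv)
    (hd : M.res d = p.1.1) (t : L.Term (Fin n)) :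
    (M.termVal (M.extend p d hd) (t.relabel Fin.castSucc)).1 = (M.termVal p t).1 :=
  (M.termVal_relabel (M.extend p d hd) Fin.castSucc t).trans
    (congrArg (fun q => (M.termVal q t).1) (M.termsVal_var_castSucc_extend p d hd))

theorem termsVal_liftSubst_extend {m n : ℕ} (p : M.tuples m) (σ : Fin n → L.Term (Fin m))
    (d : M.indiv) (hd : M.res d = p.1.1) :
    M.termsVal (Formula.liftSubst σ) (M.extend p d hd) = M.extend (M.termsVal σ p) d hd :=
  M.tuple_ext rfl fun i => by
    refine Fin.lastCases ?_ (fun j => ?_) i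
    · simp [termsVal, extend, Formula.liftSubst, termVal]
    · have h : Formula.liftSubst σ j.castSucc = (σ j).relabel Fin.castSucc := by
        simp [Formula.liftSubst]
      have h' := M.termVal_relabel_castSucc_extend p d hd (σ j)
      rw [← h] at h'
      exact h'.trans
        (Fin.snoc_castSucc (α := fun _ => M.indiv.carrier) d (M.termsVal σ p).1.2 j).symm

theorem termVal_mono {n : ℕ} {p q : M.tuples n} (h : (M.tuples n).rel p q) (t : L.Term (Fin n)) :
    M.indiv.rel (M.termVal p t).1 (M.termVal q t).1 := by
  induction t with
  | var i => exact h.2 i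
  | func f ts ih => exact M.funMap_mono f _ _ ⟨h.1, ih⟩

theorem termsVal_mono {m n : ℕ} (σ : Fin n → L.Term (Fin m)) {p q : M.tuples m}
    (h : (M.tuples m).rel p q) : (M.tuples n).rel (M.termsVal σ p) (M.termsVal σ q) :=
  ⟨h.1, fun j => M.termVal_mono h (σ j)⟩

/-- Boundedness lifts each component separately. Together with `tuple_rel_unique`, this makes the
projection from tuples to worlds a Kripke sheaf again. -/
theorem exists_tuple_rel {n : ℕ} (p : M.tuples n) (y : M.worlds) (h : M.worlds.rel p.1.1 y) :
    ∃ q : M.tuples n, (M.tuples n).rel p q ∧ q.1.1 = y := by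
  have H : ∀ i, ∃ b : M.indiv, M.indiv.rel (p.1.2 i) b ∧ M.res b = y := fun i =>
    M.sheaf.bounded.back _ _ (by rw [p.2 i]; exact h)
  choose b hb hb' using H
  exact ⟨⟨(y, b), hb'⟩, ⟨h, hb⟩, rfl⟩

theorem tuple_rel_unique {n : ℕ} {p q q' : M.tuples n} (h : (M.tuples n).rel p q)
    (h' : (M.tuples n).rel p q') (e : q.1.1 = q'.1.1) : q = q' :=
  M.tuple_ext e fun i =>
    M.sheaf.unique _ _ _ (h.2 i) (h'.2 i) ((q.2 i).trans (e.trans (q'.2 i).symm))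

section Update

variable (E : KripkeFrame.{0}) (pre : E → Set M.worlds)

theorem termVal_inject {n : ℕ} (e : E) (p : M.tuples n) (h : p.1.1 ∈ pre e)
    (t : L.Term (Fin n)) :
    ((M.update E pre).termVal (M.inject E pre e p h) t).1.1 = ((M.termVal p t).1, e) := by
  induction t with
  | var i => rfl
  | func f ts ih =>
    refine Prod.ext ?_ rfl
    exact congrArg (M.funMap f) (M.tuple_ext rfl fun i => congrArg Prod.fst (ih i))

theorem termsVal_inject {m n : ℕ} (e : E) (p : M.tuples m) (h : p.1.1 ∈ pre e)
    (σ : Fin n → L.Term (Fin m)) :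
    (M.update E pre).termsVal σ (M.inject E pre e p h) =
      M.inject E pre e (M.termsVal σ p) h :=
  (M.update E pre).tuple_ext rfl fun i => Subtype.ext (M.termVal_inject E pre e p h (σ i))

/-- All components of a tuple in the update share the event of their common world. Hence `□` in the
update quantifies over injected tuples only, as its reduction axiom requires. -/
theorem exists_eq_inject {n : ℕ} (q : (M.update E pre).tuples n) :
    ∃ h, q = M.inject E pre q.1.1.1.2 (M.updProj E pre q) h :=
  ⟨q.1.1.2, (M.update E pre).tuple_ext rfl fun i => Subtype.ext (Prod.ext rfl
    (congrArg (fun x : M.updWorlds E pre => x.1.2) (q.2 i)))⟩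

theorem inject_extend {n : ℕ} (e : E) (p : M.tuples n) (h : p.1.1 ∈ pre e) (d : M.indiv)
    (hd : M.res d = p.1.1) (hd' : M.res d ∈ pre e) :
    M.inject E pre e (M.extend p d hd) h =
      (M.update E pre).extend (M.inject E pre e p h) ⟨(d, e), hd'⟩
        (Subtype.ext (Prod.ext hd rfl)) :=
  (M.update E pre).tuple_ext rfl fun i => by
    refine Fin.lastCases ?_ (fun j => ?_) i
    · refine Subtype.ext (Eq.trans ?_ (congrArg Subtype.val
        (Fin.snoc_last (α := fun _ => (M.updIndiv E pre).carrier) _ _).symm))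
      simp [inject, extend]
    · refine Subtype.ext (Eq.trans ?_ (congrArg Subtype.val
        (Fin.snoc_castSucc (α := fun _ => (M.updIndiv E pre).carrier) _ _ _).symm))
      simp [inject, extend]

theorem frameCondition_update {S : BaseLogic} (hE : S.FrameCondition E)
    (hX : S.FrameCondition M.worlds) (hD : S.FrameCondition M.indiv) :
    S.FrameCondition (M.update E pre).worlds ∧ S.FrameCondition (M.update E pre).indiv := by
  cases S with
  | K => exact ⟨trivial, trivial⟩
  | S4 =>
    exact ⟨⟨fun x => ⟨hX.1 _, hE.1 _⟩,
      fun x y z h h' => ⟨hX.2 _ _ _ h.1 h'.1, hE.2 _ _ _ h.2 h'.2⟩⟩,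
      ⟨fun x => ⟨hD.1 _, hE.1 _⟩,
      fun x y z h h' => ⟨hD.2 _ _ _ h.1 h'.1, hE.2 _ _ _ h.2 h'.2⟩⟩⟩
  | S5 =>
    exact ⟨⟨fun x => ⟨hX.refl _, hE.refl _⟩, fun h => ⟨hX.symm h.1, hE.symm h.2⟩,
      fun h h' => ⟨hX.trans h.1 h'.1, hE.trans h.2 h'.2⟩⟩,
      ⟨fun x => ⟨hD.refl _, hE.refl _⟩, fun h => ⟨hD.symm h.1, hE.symm h.2⟩,
      fun h h' => ⟨hD.trans h.1 h'.1, hE.trans h.2 h'.2⟩⟩⟩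

end Update

theorem tuples_frameCondition {S : BaseLogic} (hX : S.FrameCondition M.worlds)
    (hD : S.FrameCondition M.indiv) (n : ℕ) : S.FrameCondition (M.tuples n) := by
  cases S with
  | K => trivial
  | S4 =>
    exact ⟨fun x => ⟨hX.1 _, fun _ => hD.1 _⟩,
      fun x y z h h' => ⟨hX.2 _ _ _ h.1 h'.1, fun i => hD.2 _ _ _ (h.2 i) (h'.2 i)⟩⟩
  | S5 =>
    exact ⟨fun x => ⟨hX.refl _, fun _ => hD.refl _⟩,
      fun h => ⟨hX.symm h.1, fun i => hD.symm (h.2 i)⟩,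
      fun h h' => ⟨hX.trans h.1 h'.1, fun i => hD.trans (h.2 i) (h'.2 i)⟩⟩

end KripkeSheafModel

namespace Formula

variable {L : FirstOrder.Language.{u, v}} {𝓔 : EventFrames.{s}}

theorem sat_subst {n : ℕ} (φ : Formula L 𝓔 n) : ∀ {m : ℕ} (σ : Fin n → L.Term (Fin m))
    (M : KripkeSheafModel.{u, v, w} L) (p : M.tuples m),
    (φ.subst σ).sat M p ↔ φ.sat M (M.termsVal σ p) := by
  induction φ with
  | top => exact fun _ _ _ => Iff.rfl
  | rel F ts =>
    intro m σ M p
    simp only [subst, sat, M.termsVal_subst]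
  | neg φ ih => exact fun σ M p => not_congr (ih σ M p)
  | and φ ψ ihφ ihψ => exact fun σ M p => and_congr (ihφ σ M p) (ihψ σ M p)
  | all φ ih =>
    intro m σ M p
    refine forall₂_congr fun d hd => ?_
    rw [ih, M.termsVal_liftSubst_extend]
  | box φ ih =>
    intro m σ M p
    constructor
    · intro h q hq
      -- A successor `q` of the value tuple need not visibly come from a successor of `p`. Lift `p`
      -- to the world of `q`; monotonicity of terms and uniqueness of successors identify the value
      -- there with `q`.
      obtain ⟨r, hr, hr'⟩ := M.exists_tuple_rel p q.1.1 hq.1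
      obtain rfl : M.termsVal σ r = q := M.tuple_rel_unique (M.termsVal_mono σ hr) hq hr'
      exact (ih σ M r).1 (h r hr)
    · intro h q hq
      exact (ih σ M q).2 (h _ (M.termsVal_mono σ hq))
  | dyn i pre e φ _ ih =>
    intro m σ M p
    refine forall_congr' fun h => ?_
    rw [ih, M.termsVal_inject]

theorem sat_imp {n : ℕ} (φ ψ : Formula L 𝓔 n) (M : KripkeSheafModel.{u, v, w} L)
    (p : M.tuples n) : (imp φ ψ).sat M p ↔ (φ.sat M p → ψ.sat M p) := by
  simp only [imp, sat]; tauto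

theorem sat_iff {n : ℕ} (φ ψ : Formula L 𝓔 n) (M : KripkeSheafModel.{u, v, w} L)
    (p : M.tuples n) : (iff φ ψ).sat M p ↔ (φ.sat M p ↔ ψ.sat M p) := by
  simp only [iff, sat, sat_imp]; tauto

theorem sat_conj {n : ℕ} (l : List (Formula L 𝓔 n)) (M : KripkeSheafModel.{u, v, w} L)
    (p : M.tuples n) : (conj l).sat M p ↔ ∀ φ ∈ l, φ.sat M p := by
  induction l with
  | nil => simp [conj, sat]
  | cons a l ih =>
    rw [List.forall_mem_cons, ← ih]
    rfl

theorem sat_conjSucc {n : ℕ} (i : 𝓔.ι) (pre : 𝓔.frame i → Formula L 𝓔 0) (e : 𝓔.frame i)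
    (φ : Formula L 𝓔 n) (M : KripkeSheafModel.{u, v, w} L) (p : M.tuples n) :
    (conjSucc i pre e φ).sat M p ↔
      ∀ e', (𝓔.frame i).rel e e' → (dyn i pre e' φ).sat M p := by
  simp [conjSucc, sat_conj]

theorem sat_ofSentence {n : ℕ} (φ : Formula L 𝓔 0) (M : KripkeSheafModel.{u, v, w} L)
    (p : M.tuples n) : (ofSentence φ : Formula L 𝓔 n).sat M p ↔ φ.sat M (M.ofWorld p.1.1) := by
  rw [ofSentence, sat_subst]
  exact iff_of_eq (congrArg _ (M.tuple_ext rfl fun i => i.elim0))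

theorem sat_weaken_extend {n : ℕ} (φ : Formula L 𝓔 n) (M : KripkeSheafModel.{u, v, w} L)
    (p : M.tuples n) (d : M.indiv) (hd : M.res d = p.1.1) :
    φ.weaken.sat M (M.extend p d hd) ↔ φ.sat M p := by
  rw [weaken, sat_subst, M.termsVal_var_castSucc_extend]

theorem sat_inst {n : ℕ} (φ : Formula L 𝓔 (n + 1)) (t : L.Term (Fin n))
    (M : KripkeSheafModel.{u, v, w} L) (p : M.tuples n) :
    (φ.inst t).sat M p ↔ φ.sat M (M.extend p (M.termVal p t).1 (M.termVal p t).2) := by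
  rw [inst, sat_subst, M.termsVal_snoc_var]

end Formula

open Formula in
/-- Soundness. -/
theorem Provable.valid {S : BaseLogic} {L : FirstOrder.Language.{u, v}} {𝓔 : EventFrames.{s}}
    (h𝓔 : ∀ i, S.FrameCondition (𝓔.frame i)) {n : ℕ} {φ : Formula L 𝓔 n}
    (h : Provable S φ) : Valid.{u, v, s, w} S φ := by
  induction h with
  | taut h =>
    intro M hX hD p
    exact h (fun ψ => ψ.sat M p) trivial (fun _ => Iff.rfl) fun _ _ => Iff.rfl
  | mp _ _ ih₁ ih₂ =>
    intro M hX hD p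
    exact (sat_imp _ _ M p).1 (ih₁ M hX hD p) (ih₂ M hX hD p)
  | all_inst φ t =>
    intro M hX hD p
    rw [sat_imp, sat_inst]
    exact fun h => h _ _
  | all_dist φ ψ =>
    intro M hX hD p
    simp only [sat_imp, sat]
    exact fun h h' d hd => h d hd (h' d hd)
  | all_vacuous φ =>
    intro M hX hD p
    simp only [sat_iff, sat, sat_weaken_extend]
    -- Surjectivity of the residence map: a vacuous quantifier ranges over a nonempty fibre.
    obtain ⟨d, hd⟩ := M.surj p.1.1
    exact ⟨fun h => h d hd, fun h _ _ => h⟩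
  | gen _ ih => exact fun M hX hD p d hd => ih M hX hD _
  | box_dist φ ψ =>
    intro M hX hD p
    simp only [sat_imp, sat]
    exact fun h h' q hq => h q hq (h' q hq)
  | box_nec _ ih => exact fun M hX hD p q _ => ih M hX hD q
  | @base n φ h =>
    intro M hX hD p
    have hT := M.tuples_frameCondition hX hD n
    cases h with
    | refl_S4 φ =>
      rw [sat_imp]
      exact fun h => h p (hT.1 p)
    | trans_S4 φ =>
      rw [sat_imp]
      exact fun h q hq r hr => h r (hT.2 _ _ _ hq hr)
    | refl_S5 φ =>
      rw [sat_imp]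
      exact fun h => h p (hT.refl p)
    | trans_S5 φ =>
      rw [sat_imp]
      exact fun h q hq r hr => h r (hT.trans hq hr)
    | eucl_S5 φ =>
      rw [sat_imp]
      exact fun h q hq h' => h fun r hr => h' r (hT.trans (hT.symm hq) hr)
  | dyn_dist i pre e φ ψ =>
    intro M hX hD p
    simp only [sat_imp, sat]
    exact fun h h' hp => h hp (h' hp)
  | dyn_nec i pre e _ ih =>
    intro M hX hD p hp
    -- The induction hypothesis is applied to the updated model, which stays in the class because
    -- the event frame satisfies the same frame condition.
    obtain ⟨hX', hD'⟩ := M.frameCondition_update (𝓔.frame i) _ (h𝓔 i) hX hD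
    exact ih _ hX' hD' _
  | red_rel i pre e F ts =>
    intro M hX hD p
    rw [sat_iff, sat_imp, sat_ofSentence]
    refine forall_congr' fun h => ?_
    simp only [sat]
    rw [M.termsVal_inject]
    rfl
  | red_neg i pre e φ =>
    intro M hX hD p
    rw [sat_iff, sat_imp, sat_ofSentence]
    simp only [sat]
    exact ⟨fun h hp h' => h hp (h' hp), fun h hp h' => h hp fun _ => h'⟩
  | red_top i pre e =>
    intro M hX hD p
    rw [sat_iff]
    exact iff_of_true (fun _ => trivial) trivial
  | red_and i pre e φ ψ =>
    intro M hX hD p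
    rw [sat_iff]
    exact forall_and
  | red_box i pre e φ =>
    intro M hX hD p
    rw [sat_iff, sat_imp, sat_ofSentence]
    refine forall_congr' fun h => ?_
    simp only [sat, sat_conjSucc]
    constructor
    · intro H q hq e' he' hq'
      exact H _ ⟨⟨hq.1, he'⟩, fun i => ⟨hq.2 i, he'⟩⟩
    · intro H q hq
      obtain ⟨hq', hq''⟩ := M.exists_eq_inject _ _ q
      rw [hq'']
      exact H (M.updProj _ _ q) ⟨hq.1.1, fun i => (hq.2 i).1⟩ _ hq.1.2 hq'
  | red_all i pre e φ =>
    intro M hX hD p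
    rw [sat_iff]
    simp only [sat]
    constructor
    · intro H d hd h
      have hd' : (pre e).sat M (M.ofWorld (M.res d)) := by rw [hd]; exact h
      have := H h ⟨(d, e), hd'⟩ (Subtype.ext (Prod.ext hd rfl))
      exact (congrArg (φ.sat _) (M.inject_extend (𝓔.frame i) _ e p h d hd hd')).mpr this
    · rintro H h ⟨⟨d, e'⟩, hd'⟩ hd
      obtain ⟨h1, h2⟩ := Prod.mk.inj (congrArg Subtype.val hd)
      obtain rfl : e' = e := h2
      exact (congrArg (φ.sat _) (M.inject_extend (𝓔.frame i) _ e' p h d h1 hd')).mp (H d h1 h)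

/-! ### Propositional reasoning -/

namespace Formula

variable {L : FirstOrder.Language.{u, v}} {𝓔 : EventFrames.{s}}

/-- An assignment of truth values to formulas which respects `⊤`, `¬` and `∧`. -/
structure IsValuation {n : ℕ} (V : Formula L 𝓔 n → Prop) : Prop where
  top : V top
  neg : ∀ ψ, V (neg ψ) ↔ ¬ V ψ
  and : ∀ ψ χ, V (and ψ χ) ↔ V ψ ∧ V χ

namespace IsValuation

variable {n : ℕ} {V : Formula L 𝓔 n → Prop}

theorem imp (hV : IsValuation V) (ψ χ : Formula L 𝓔 n) : V (imp ψ χ) ↔ (V ψ → V χ) := by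
  simp only [Formula.imp, hV.neg, hV.and]; tauto

theorem iff (hV : IsValuation V) (ψ χ : Formula L 𝓔 n) : V (iff ψ χ) ↔ (V ψ ↔ V χ) := by
  simp only [Formula.iff, hV.imp, hV.and]; tauto

end IsValuation

end Formula

namespace Provable

open Formula

variable {S : BaseLogic} {L : FirstOrder.Language.{u, v}} {𝓔 : EventFrames.{s}} {n : ℕ}

/-- Propositional consequences of provable formulas are provable. -/
theorem of_valuations (l : List (Formula L 𝓔 n)) (hl : ∀ ψ ∈ l, Provable S ψ) :
    ∀ {φ : Formula L 𝓔 n}, (∀ V, IsValuation V → (∀ ψ ∈ l, V ψ) → V φ) → Provable S φ := by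
  induction l with
  | nil =>
    intro φ h
    exact taut fun V h₁ h₂ h₃ => h V ⟨h₁, h₂, h₃⟩ (by simp)
  | cons a l ih =>
    intro φ h
    rw [List.forall_mem_cons] at hl
    refine mp (ih hl.2 fun V hV h' => (hV.imp a φ).2 fun ha => h V hV ?_) hl.1
    exact List.forall_mem_cons.2 ⟨ha, h'⟩

theorem of_valuations₁ {φ ψ : Formula L 𝓔 n} (h₁ : Provable S φ)
    (h : ∀ V, IsValuation V → V φ → V ψ) : Provable S ψ :=
  of_valuations [φ] (by simpa using h₁) (by simpa using h)

theorem of_valuations₂ {φ₁ φ₂ ψ : Formula L 𝓔 n} (h₁ : Provable S φ₁) (h₂ : Provable S φ₂)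
    (h : ∀ V, IsValuation V → V φ₁ → V φ₂ → V ψ) : Provable S ψ :=
  of_valuations [φ₁, φ₂] (by simpa using ⟨h₁, h₂⟩) (by simpa using h)

theorem iff_refl (φ : Formula L 𝓔 n) : Provable S (iff φ φ) :=
  of_valuations [] (by simp) fun V hV _ => (hV.iff _ _).2 Iff.rfl

theorem iff_trans {φ ψ χ : Formula L 𝓔 n} (h₁ : Provable S (iff φ ψ))
    (h₂ : Provable S (iff ψ χ)) : Provable S (iff φ χ) :=
  of_valuations₂ h₁ h₂ fun V hV => by simp only [hV.iff]; exact Iff.trans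

theorem iff_left {φ ψ : Formula L 𝓔 n} (h : Provable S (iff φ ψ)) : Provable S (imp φ ψ) :=
  of_valuations₁ h fun V hV => by simp only [hV.iff, hV.imp]; exact Iff.mp

theorem iff_right {φ ψ : Formula L 𝓔 n} (h : Provable S (iff φ ψ)) : Provable S (imp ψ φ) :=
  of_valuations₁ h fun V hV => by simp only [hV.iff, hV.imp]; exact Iff.mpr

theorem iff_intro {φ ψ : Formula L 𝓔 n} (h₁ : Provable S (imp φ ψ))
    (h₂ : Provable S (imp ψ φ)) : Provable S (iff φ ψ) :=
  of_valuations₂ h₁ h₂ fun V hV => by simp only [hV.iff, hV.imp]; exact Iff.intro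

theorem iff_neg {φ ψ : Formula L 𝓔 n} (h : Provable S (iff φ ψ)) :
    Provable S (iff (neg φ) (neg ψ)) :=
  of_valuations₁ h fun V hV => by simp only [hV.iff, hV.neg]; exact not_congr

theorem iff_and {φ φ' ψ ψ' : Formula L 𝓔 n} (h : Provable S (iff φ φ'))
    (h' : Provable S (iff ψ ψ')) : Provable S (iff (and φ ψ) (and φ' ψ')) :=
  of_valuations₂ h h' fun V hV => by simp only [hV.iff, hV.and]; exact and_congr

theorem iff_imp {φ φ' ψ ψ' : Formula L 𝓔 n} (h : Provable S (iff φ φ'))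
    (h' : Provable S (iff ψ ψ')) : Provable S (iff (imp φ ψ) (imp φ' ψ')) :=
  of_valuations₂ h h' fun V hV => by simp only [hV.iff, hV.imp]; exact imp_congr

theorem iff_all {φ ψ : Formula L 𝓔 (n + 1)} (h : Provable S (iff φ ψ)) :
    Provable S (iff (all φ) (all ψ)) :=
  iff_intro (mp (all_dist _ _) (gen h.iff_left)) (mp (all_dist _ _) (gen h.iff_right))

theorem iff_box {φ ψ : Formula L 𝓔 n} (h : Provable S (iff φ ψ)) :
    Provable S (iff (box φ) (box ψ)) :=
  iff_intro (mp (box_dist _ _) (box_nec h.iff_left)) (mp (box_dist _ _) (box_nec h.iff_right))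

theorem iff_dyn (i : 𝓔.ι) (pre : 𝓔.frame i → Formula L 𝓔 0) (e : 𝓔.frame i)
    {φ ψ : Formula L 𝓔 n} (h : Provable S (iff φ ψ)) :
    Provable S (iff (dyn i pre e φ) (dyn i pre e ψ)) :=
  iff_intro (mp (dyn_dist i pre e _ _) (dyn_nec i pre e h.iff_left))
    (mp (dyn_dist i pre e _ _) (dyn_nec i pre e h.iff_right))

theorem iff_conj_map {α : Type*} (l : List α) {f g : α → Formula L 𝓔 n}
    (h : ∀ a, Provable S (iff (f a) (g a))) :
    Provable S (iff (conj (l.map f)) (conj (l.map g))) := by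
  induction l with
  | nil => exact iff_refl _
  | cons a l ih => exact iff_and (h a) ih

end Provable

/-! ### Terms -/

section Terms

variable {L : FirstOrder.Language.{u, v}} {α : Type*} {β : Type*} {γ : Type*}

theorem term_subst_subst (t : L.Term α) (σ : α → L.Term β) (τ : β → L.Term γ) :
    (t.subst σ).subst τ = t.subst fun a => (σ a).subst τ := by
  induction t with
  | var a => rfl
  | func f ts ih => simp only [Language.Term.subst, ih]

theorem term_relabel_subst (t : L.Term α) (g : α → β) (τ : β → L.Term γ) :
    (t.relabel g).subst τ = t.subst fun a => τ (g a) := by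
  induction t with
  | var a => rfl
  | func f ts ih => simp only [Language.Term.subst, Language.Term.relabel, ih]

theorem term_subst_relabel (t : L.Term α) (σ : α → L.Term β) (g : β → γ) :
    (t.subst σ).relabel g = t.subst fun a => (σ a).relabel g := by
  induction t with
  | var a => rfl
  | func f ts ih => simp only [Language.Term.subst, Language.Term.relabel, ih]

theorem term_subst_var (t : L.Term α) : t.subst Language.Term.var = t := by
  induction t with
  | var a => rfl
  | func f ts ih => simp only [Language.Term.subst, ih]

theorem term_subst_var_comp (t : L.Term α) (g : α → β) :
    t.subst (fun a => Language.Term.var (g a)) = t.relabel g := by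
  induction t with
  | var a => rfl
  | func f ts ih => simp only [Language.Term.subst, Language.Term.relabel, ih]

theorem onTerm_subst {L' : FirstOrder.Language.{u', v'}} (ι : L →ᴸ L') (t : L.Term α)
    (σ : α → L.Term β) :
    ι.onTerm (t.subst σ) = (ι.onTerm t).subst fun a => ι.onTerm (σ a) := by
  induction t with
  | var a => rfl
  | func f ts ih => simp only [Language.Term.subst, Language.LHom.onTerm, ih]

theorem onTerm_relabel {L' : FirstOrder.Language.{u', v'}} (ι : L →ᴸ L') (t : L.Term α)
    (g : α → β) : ι.onTerm (t.relabel g) = (ι.onTerm t).relabel g := by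
  induction t with
  | var a => rfl
  | func f ts ih => simp only [Language.Term.relabel, Language.LHom.onTerm, ih]

end Terms

/-! ### Static formulas -/

/-- Formulas without dynamic operators whose free variables are named by natural numbers. A
quantifier binds the variable `0` and shifts the names of all others. -/
inductive SForm (L : FirstOrder.Language.{u, v}) : Type (max u v)
  | top : SForm L
  | rel {k : ℕ} (F : L.Relations k) (ts : Fin k → L.Term ℕ) : SForm L
  | neg (φ : SForm L) : SForm L
  | and (φ ψ : SForm L) : SForm L
  | all (φ : SForm L) : SForm L
  | box (φ : SForm L) : SForm L

/-- Prepends `t` to a sequence of terms. -/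
def consTerm {T : Type*} (t : T) (s : ℕ → T) : ℕ → T
  | 0 => t
  | j + 1 => s j

namespace SForm

section

variable {L : FirstOrder.Language.{u, v}}

/-- Implication. -/
def imp (φ ψ : SForm L) : SForm L := neg (and φ (neg ψ))

/-- Finite conjunction. -/
def conj (l : List (SForm L)) : SForm L := l.foldr and top

/-- The extension of a substitution to the scope of a quantifier. -/
def lift (s : ℕ → L.Term ℕ) : ℕ → L.Term ℕ :=
  consTerm (Language.Term.var 0) fun j => (s j).relabel Nat.succ

/-- Simultaneous substitution. -/
def subst : SForm L → (ℕ → L.Term ℕ) → SForm L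
  | top, _ => top
  | rel F ts, s => rel F fun j => (ts j).subst s
  | neg φ, s => neg (φ.subst s)
  | and φ ψ, s => and (φ.subst s) (ψ.subst s)
  | all φ, s => all (φ.subst (lift s))
  | box φ, s => box (φ.subst s)

/-- Substitution of `t` for the variable `0`. -/
def inst (φ : SForm L) (t : L.Term ℕ) : SForm L :=
  φ.subst (consTerm t Language.Term.var)

/-- Renaming of free variables. -/
def rename (φ : SForm L) (g : ℕ → ℕ) : SForm L :=
  φ.subst fun j => Language.Term.var (g j)

theorem lift_subst (s s' : ℕ → L.Term ℕ) :
    (fun j => (lift s j).subst (lift s')) = lift fun j => (s j).subst s' := by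
  funext j
  cases j with
  | zero => rfl
  | succ j =>
    change ((s j).relabel Nat.succ).subst (lift s') = ((s j).subst s').relabel Nat.succ
    rw [term_relabel_subst, term_subst_relabel]
    rfl

theorem lift_var : lift (Language.Term.var : ℕ → L.Term ℕ) = Language.Term.var := by
  funext j
  cases j <;> rfl

theorem subst_subst (φ : SForm L) : ∀ s s' : ℕ → L.Term ℕ,
    (φ.subst s).subst s' = φ.subst fun j => (s j).subst s' := by
  induction φ with
  | top => exact fun _ _ => rfl
  | rel F ts => intro s s'; simp only [subst, term_subst_subst]
  | neg φ ih => intro s s'; simp only [subst, ih]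
  | and φ ψ ihφ ihψ => intro s s'; simp only [subst, ihφ, ihψ]
  | all φ ih => intro s s'; simp only [subst, ih, lift_subst]
  | box φ ih => intro s s'; simp only [subst, ih]

theorem subst_var (φ : SForm L) : φ.subst Language.Term.var = φ := by
  induction φ with
  | top => rfl
  | rel F ts => simp only [subst, term_subst_var]
  | neg φ ih => simp only [subst, ih]
  | and φ ψ ihφ ihψ => simp only [subst, ihφ, ihψ]
  | all φ ih => simp only [subst, lift_var, ih]
  | box φ ih => simp only [subst, ih]

theorem subst_lift_inst (φ : SForm L) (s : ℕ → L.Term ℕ) (t : L.Term ℕ) :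
    (φ.subst (lift s)).inst t = φ.subst (consTerm t s) := by
  rw [inst, subst_subst]
  congr 1
  funext j
  cases j with
  | zero => rfl
  | succ j => exact (term_relabel_subst _ _ _).trans (term_subst_var _)

theorem exists_term_bound {β : Type*} (t : L.Term ℕ) :
    ∃ N, ∀ s s' : ℕ → L.Term β, (∀ j < N, s j = s' j) → t.subst s = t.subst s' := by
  induction t with
  | var a => exact ⟨a + 1, fun s s' h => h a (Nat.lt_succ_self a)⟩
  | func f ts ih =>
    choose N hN using ih
    refine ⟨Finset.univ.sup N, fun s s' h => ?_⟩
    simp only [Language.Term.subst]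
    congr 1
    funext i
    exact hN i s s' fun j hj => h j (hj.trans_le (Finset.le_sup (Finset.mem_univ i)))

/-- A formula has finitely many free variables. -/
theorem exists_bound (φ : SForm L) :
    ∃ N, ∀ s s' : ℕ → L.Term ℕ, (∀ j < N, s j = s' j) → φ.subst s = φ.subst s' := by
  induction φ with
  | top => exact ⟨0, fun _ _ _ => rfl⟩
  | rel F ts =>
    choose N hN using fun i => exists_term_bound (β := ℕ) (ts i)
    refine ⟨Finset.univ.sup N, fun s s' h => ?_⟩
    simp only [subst]
    congr 1
    funext i
    exact hN i s s' fun j hj => h j (hj.trans_le (Finset.le_sup (Finset.mem_univ i)))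
  | neg φ ih =>
    obtain ⟨N, hN⟩ := ih
    exact ⟨N, fun s s' h => congrArg neg (hN s s' h)⟩
  | and φ ψ ihφ ihψ =>
    obtain ⟨N, hN⟩ := ihφ
    obtain ⟨N', hN'⟩ := ihψ
    exact ⟨max N N', fun s s' h => congrArg₂ and
      (hN s s' fun j hj => h j (hj.trans_le (le_max_left _ _)))
      (hN' s s' fun j hj => h j (hj.trans_le (le_max_right _ _)))⟩
  | all φ ih =>
    obtain ⟨N, hN⟩ := ih
    -- The bound `N` need not be lowered: index `0` is bound, and index `j + 1 < N` refers to the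
    -- outer variable `j < N`.
    refine ⟨N, fun s s' h => congrArg all (hN _ _ fun j hj => ?_)⟩
    cases j with
    | zero => rfl
    | succ j => exact congrArg _ (h j (Nat.lt_of_succ_lt hj))
  | box φ ih =>
    obtain ⟨N, hN⟩ := ih
    exact ⟨N, fun s s' h => congrArg box (hN s s' h)⟩

/-- An assignment of truth values to formulas which respects `⊤`, `¬` and `∧`. -/
structure IsValuation (V : SForm L → Prop) : Prop where
  top : V top
  neg : ∀ ψ, V (neg ψ) ↔ ¬ V ψ
  and : ∀ ψ χ, V (and ψ χ) ↔ V ψ ∧ V χ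

theorem IsValuation.imp {V : SForm L → Prop} (hV : IsValuation V) (ψ χ : SForm L) :
    V (imp ψ χ) ↔ (V ψ → V χ) := by
  simp only [SForm.imp, hV.neg, hV.and]; tauto

end

section ToForm

variable {L₀ : FirstOrder.Language.{u', v'}} {L : FirstOrder.Language.{u, v}}
  {𝓔 : EventFrames.{s}} (ι : L₀ →ᴸ L)

/-- The extension to the scope of a quantifier of an assignment of terms in context to variables. -/
def liftCtx {n : ℕ} (σ : ℕ → L.Term (Fin n)) : ℕ → L.Term (Fin (n + 1)) :=
  consTerm (Language.Term.var (Fin.last n)) fun j => (σ j).relabel Fin.castSucc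

/-- The formula in context that results from a static formula by translating its symbols and
substituting terms in context for its free variables. -/
def toForm : SForm L₀ → {n : ℕ} → (ℕ → L.Term (Fin n)) → Formula L 𝓔 n
  | top, _, _ => .top
  | rel F ts, _, σ => .rel (ι.onRelation F) fun j => (ι.onTerm (ts j)).subst σ
  | neg φ, _, σ => .neg (φ.toForm σ)
  | and φ ψ, _, σ => .and (φ.toForm σ) (ψ.toForm σ)
  | all φ, _, σ => .all (φ.toForm (liftCtx σ))
  | box φ, _, σ => .box (φ.toForm σ)

theorem toForm_imp (φ ψ : SForm L₀) {n : ℕ} (σ : ℕ → L.Term (Fin n)) :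
    ((φ.imp ψ).toForm ι σ : Formula L 𝓔 n) = (φ.toForm ι σ).imp (ψ.toForm ι σ) :=
  rfl

theorem toForm_conj_map {α : Type*} (l : List α) (f : α → SForm L₀) {n : ℕ}
    (σ : ℕ → L.Term (Fin n)) :
    ((conj (l.map f)).toForm ι σ : Formula L 𝓔 n) =
      Formula.conj (l.map fun a => (f a).toForm ι σ) := by
  induction l with
  | nil => rfl
  | cons a l ih => exact congrArg (Formula.and _) ih

theorem liftCtx_subst {m n : ℕ} (σ : ℕ → L.Term (Fin n)) (τ : Fin n → L.Term (Fin m)) :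
    (fun j => (liftCtx σ j).subst (Formula.liftSubst τ)) = liftCtx fun j => (σ j).subst τ := by
  funext j
  cases j with
  | zero => simp [liftCtx, consTerm, Language.Term.subst, Formula.liftSubst]
  | succ j =>
    simp [liftCtx, consTerm, Formula.liftSubst, term_relabel_subst, term_subst_relabel]

theorem toForm_formula_subst (φ : SForm L₀) : ∀ {m n : ℕ} (σ : ℕ → L.Term (Fin n))
    (τ : Fin n → L.Term (Fin m)),
    (φ.toForm ι σ : Formula L 𝓔 n).subst τ = φ.toForm ι fun j => (σ j).subst τ := by
  induction φ with
  | top => exact fun _ _ => rfl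
  | rel F ts => intro m n σ τ; simp only [toForm, Formula.subst, term_subst_subst]
  | neg φ ih => intro m n σ τ; simp only [toForm, Formula.subst, ih]
  | and φ ψ ihφ ihψ => intro m n σ τ; simp only [toForm, Formula.subst, ihφ, ihψ]
  | all φ ih => intro m n σ τ; simp only [toForm, Formula.subst, ih, liftCtx_subst]
  | box φ ih => intro m n σ τ; simp only [toForm, Formula.subst, ih]

theorem lift_onTerm_subst_liftCtx {n : ℕ} (s : ℕ → L₀.Term ℕ) (σ : ℕ → L.Term (Fin n)) :
    (fun j => (ι.onTerm (lift s j)).subst (liftCtx σ)) =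
      liftCtx fun j => (ι.onTerm (s j)).subst σ := by
  funext j
  cases j with
  | zero => rfl
  | succ j =>
    change (ι.onTerm ((s j).relabel Nat.succ)).subst (liftCtx σ) =
      ((ι.onTerm (s j)).subst σ).relabel Fin.castSucc
    rw [onTerm_relabel, term_relabel_subst, term_subst_relabel]
    rfl

theorem toForm_subst (φ : SForm L₀) : ∀ {n : ℕ} (s : ℕ → L₀.Term ℕ) (σ : ℕ → L.Term (Fin n)),
    ((φ.subst s).toForm ι σ : Formula L 𝓔 n) =
      φ.toForm ι fun j => (ι.onTerm (s j)).subst σ := by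
  induction φ with
  | top => exact fun _ _ => rfl
  | rel F ts => intro n s σ; simp only [toForm, subst, onTerm_subst, term_subst_subst]
  | neg φ ih => intro n s σ; simp only [toForm, subst, ih]
  | and φ ψ ihφ ihψ => intro n s σ; simp only [toForm, subst, ihφ, ihψ]
  | all φ ih => intro n s σ; simp only [toForm, subst, ih, lift_onTerm_subst_liftCtx]
  | box φ ih => intro n s σ; simp only [toForm, subst, ih]

theorem toForm_inst (φ : SForm L₀) (t : L₀.Term ℕ) {n : ℕ} (σ : ℕ → L.Term (Fin n)) :
    ((φ.inst t).toForm ι σ : Formula L 𝓔 n) =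
      (φ.toForm ι (liftCtx σ)).inst ((ι.onTerm t).subst σ) := by
  rw [inst, toForm_subst, Formula.inst, toForm_formula_subst]
  congr 1
  funext j
  cases j with
  | zero => simp [consTerm, liftCtx, Language.Term.subst]
  | succ j =>
    simp only [consTerm, liftCtx, Language.Term.subst, Language.LHom.onTerm, term_relabel_subst,
      Fin.snoc_castSucc]
    exact (term_subst_var _).symm

theorem toForm_rename_succ (φ : SForm L₀) {n : ℕ} (σ : ℕ → L.Term (Fin n)) :
    ((φ.rename Nat.succ).toForm ι (liftCtx σ) : Formula L 𝓔 (n + 1)) =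
      (φ.toForm ι σ).weaken := by
  rw [rename, toForm_subst, Formula.weaken, toForm_formula_subst]
  congr 1
  funext j
  exact (term_subst_var_comp _ _).symm

end ToForm

end SForm

/-! ### Elimination of the dynamic operators -/

section Reduction

variable {L : FirstOrder.Language.{u, v}} {𝓔 : EventFrames.{s}}

/-- The static formula to which the reduction axioms reduce `[E, e] φ`, for static preconditions
and static `φ`. -/
noncomputable def SForm.reduceDyn (i : 𝓔.ι) (pre : 𝓔.frame i → SForm L) :
    SForm L → 𝓔.frame i → SForm L
  | .top, _ => .top
  | .rel F ts, e => (pre e).imp (.rel F ts)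
  | .neg φ, e => (pre e).imp (.neg (reduceDyn i pre φ e))
  | .and φ ψ, e => .and (reduceDyn i pre φ e) (reduceDyn i pre ψ e)
  | .all φ, e => .all (reduceDyn i pre φ e)
  | .box φ, e => (pre e).imp
      (.box (.conj ((𝓔.finite_succ i e).toFinset.toList.map fun e' => reduceDyn i pre φ e')))

/-- The static formula to which a formula in context reduces, where `ρ` names the variables of the
context. -/
noncomputable def Formula.reduce : {n : ℕ} → Formula L 𝓔 n → (Fin n → ℕ) → SForm L
  | _, top, _ => .top
  | _, rel F ts, ρ => .rel F fun j => (ts j).relabel ρ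
  | _, neg φ, ρ => .neg (φ.reduce ρ)
  | _, and φ ψ, ρ => .and (φ.reduce ρ) (ψ.reduce ρ)
  | _, all φ, ρ => .all (φ.reduce (Fin.snoc (α := fun _ => ℕ) (fun i => ρ i + 1) 0))
  | _, box φ, ρ => .box (φ.reduce ρ)
  | _, dyn i pre e φ, ρ => (φ.reduce ρ).reduceDyn i (fun e' => (pre e').reduce Fin.elim0) e

variable {S : BaseLogic}

-- One reduction axiom per connective. The event and context vary in the induction, since `□` passes
-- to other events and `∀` to a larger context.
open Formula in
theorem provable_dyn_iff_reduceDyn (i : 𝓔.ι) (pre : 𝓔.frame i → Formula L 𝓔 0)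
    (preS : 𝓔.frame i → SForm L)
    (hpre : ∀ (e : 𝓔.frame i) {n : ℕ} (σ : ℕ → L.Term (Fin n)),
      Provable S (iff (ofSentence (pre e)) ((preS e).toForm (.id L) σ)))
    (φ : SForm L) : ∀ (e : 𝓔.frame i) {n : ℕ} (σ : ℕ → L.Term (Fin n)),
    Provable S (iff (dyn i pre e (φ.toForm (.id L) σ))
      ((φ.reduceDyn i preS e).toForm (.id L) σ)) := by
  induction φ with
  | top => exact fun e n σ => .red_top i pre e
  | rel F ts =>
    exact fun e n σ => (Provable.red_rel i pre e _ _).iff_trans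
      ((hpre e σ).iff_imp (.iff_refl _))
  | neg φ ih =>
    exact fun e n σ => (Provable.red_neg i pre e _).iff_trans
      ((hpre e σ).iff_imp (ih e σ).iff_neg)
  | and φ ψ ihφ ihψ =>
    exact fun e n σ => (Provable.red_and i pre e _ _).iff_trans ((ihφ e σ).iff_and (ihψ e σ))
  | all φ ih =>
    exact fun e n σ => (Provable.red_all i pre e _).iff_trans (ih e _).iff_all
  | box φ ih =>
    intro e n σ
    refine (Provable.red_box i pre e _).iff_trans ((hpre e σ).iff_imp (Provable.iff_box ?_))
    rw [SForm.toForm_conj_map]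
    exact Provable.iff_conj_map _ fun e' => ih e' σ

-- Innermost operators go first: the body and the preconditions of `[E, e]` are already static when
-- the operator is pushed inwards. The substitution instance appears on the left so that the
-- quantifier case can extend the context.
open Formula in
theorem provable_subst_iff_reduce {n : ℕ} (φ : Formula L 𝓔 n) : ∀ (ρ : Fin n → ℕ) {m : ℕ}
    (σ : ℕ → L.Term (Fin m)),
    Provable S (iff (φ.subst fun j => σ (ρ j)) ((φ.reduce ρ).toForm (.id L) σ)) := by
  induction φ with
  | top => exact fun ρ m σ => .iff_refl _
  | rel F ts =>
    intro ρ m σ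
    simp only [subst, reduce, SForm.toForm, Language.LHom.id_onTerm, id, term_relabel_subst]
    exact .iff_refl _
  | neg φ ih => exact fun ρ m σ => (ih ρ σ).iff_neg
  | and φ ψ ihφ ihψ => exact fun ρ m σ => (ihφ ρ σ).iff_and (ihψ ρ σ)
  | all φ ih =>
    intro ρ m σ
    have h := (ih (Fin.snoc (α := fun _ => ℕ) (fun i => ρ i + 1) 0) (SForm.liftCtx σ)).iff_all
    have e : (fun j => SForm.liftCtx σ (Fin.snoc (α := fun _ => ℕ) (fun i => ρ i + 1) 0 j)) =
        liftSubst fun j => σ (ρ j) := by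
      funext j
      refine Fin.lastCases ?_ (fun j => ?_) j
      · simp [liftSubst, SForm.liftCtx, consTerm]
      · simp [liftSubst, SForm.liftCtx, consTerm]
    rw [e] at h
    exact h
  | box φ ih => exact fun ρ m σ => (ih ρ σ).iff_box
  | dyn i pre e φ ihpre ih =>
    intro ρ m σ
    refine (Provable.iff_dyn i pre e (ih ρ σ)).iff_trans
      (provable_dyn_iff_reduceDyn i pre _ (fun e' m' σ' => ?_) _ e σ)
    convert ihpre e' Fin.elim0 σ' using 2
    unfold ofSentence
    congr 1
    funext j
    exact j.elim0

end Reduction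

/-! ### Static logics, theories closed under the Henkin rule, and worlds -/

namespace SForm

section Logics

variable {L : FirstOrder.Language.{u, v}}

/-- A set of static formulas that contains the axioms and is closed under the rules of first-order
logic over a base logic. -/
structure IsLogic (S : BaseLogic) (D : Set (SForm L)) : Prop where
  taut : ∀ {φ}, (∀ V, IsValuation V → V φ) → φ ∈ D
  mp : ∀ {φ ψ}, imp φ ψ ∈ D → φ ∈ D → ψ ∈ D
  subst : ∀ {φ} (s : ℕ → L.Term ℕ), φ ∈ D → φ.subst s ∈ D
  all_inst : ∀ φ t, imp (all φ) (φ.inst t) ∈ D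
  all_dist : ∀ φ ψ, imp (all (imp φ ψ)) (imp (all φ) (all ψ)) ∈ D
  all_vacuous : ∀ φ, imp φ (all (φ.rename Nat.succ)) ∈ D
  gen : ∀ {φ}, φ ∈ D → all φ ∈ D
  box_dist : ∀ φ ψ, imp (box (imp φ ψ)) (imp (box φ) (box ψ)) ∈ D
  box_nec : ∀ {φ}, φ ∈ D → box φ ∈ D
  box_refl : S ≠ .K → ∀ φ, imp (box φ) φ ∈ D
  box_trans : S ≠ .K → ∀ φ, imp (box φ) (box (box φ)) ∈ D
  box_eucl : S = .S5 → ∀ φ, imp (neg (box φ)) (box (neg (box φ))) ∈ D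

/-- A theory over a logic that is closed under the rule which infers `∀ x. φ` from all instances
of `φ` at variables. -/
structure IsTheory (D T : Set (SForm L)) : Prop where
  logic : D ⊆ T
  mp : ∀ {φ ψ}, imp φ ψ ∈ T → φ ∈ T → ψ ∈ T
  henkin : ∀ {φ}, (∀ v, φ.inst (Language.Term.var v) ∈ T) → all φ ∈ T

/-- A complete consistent theory with witnesses. -/
structure IsWorld (D w : Set (SForm L)) : Prop where
  val : IsValuation (· ∈ w)
  logic : D ⊆ w
  henkin : ∀ {φ}, (∀ v, φ.inst (Language.Term.var v) ∈ w) → all φ ∈ w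

/-- Closure under propositional consequence. -/
theorem mem_of_valuations {T : Set (SForm L)}
    (taut : ∀ {φ}, (∀ V, IsValuation V → V φ) → φ ∈ T)
    (mp : ∀ {φ ψ}, imp φ ψ ∈ T → φ ∈ T → ψ ∈ T)
    (l : List (SForm L)) (hl : ∀ ψ ∈ l, ψ ∈ T) :
    ∀ {φ : SForm L}, (∀ V, IsValuation V → (∀ ψ ∈ l, V ψ) → V φ) → φ ∈ T := by
  induction l with
  | nil => exact fun h => taut fun V hV => h V hV (by simp)
  | cons a l ih =>
    intro φ h
    rw [List.forall_mem_cons] at hl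
    refine mp (ih hl.2 fun V hV h' => (hV.imp a φ).2 fun ha => h V hV ?_) hl.1
    exact List.forall_mem_cons.2 ⟨ha, h'⟩

variable {S : BaseLogic} {D T w : Set (SForm L)}

namespace IsLogic

theorem of_valuations₁ (hD : IsLogic S D) {φ ψ : SForm L} (h₁ : φ ∈ D)
    (h : ∀ V, IsValuation V → V φ → V ψ) : ψ ∈ D :=
  mem_of_valuations hD.taut hD.mp [φ] (by simpa using h₁) (by simpa using h)

theorem of_valuations₂ (hD : IsLogic S D) {φ₁ φ₂ ψ : SForm L} (h₁ : φ₁ ∈ D) (h₂ : φ₂ ∈ D)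
    (h : ∀ V, IsValuation V → V φ₁ → V φ₂ → V ψ) : ψ ∈ D :=
  mem_of_valuations hD.taut hD.mp [φ₁, φ₂] (by simpa using ⟨h₁, h₂⟩) (by simpa using h)

theorem imp_trans (hD : IsLogic S D) {φ ψ χ : SForm L} (h₁ : imp φ ψ ∈ D) (h₂ : imp ψ χ ∈ D) :
    imp φ χ ∈ D :=
  hD.of_valuations₂ h₁ h₂ fun V hV => by simp only [hV.imp]; tauto

theorem imp_box (hD : IsLogic S D) {φ ψ : SForm L} (h : imp φ ψ ∈ D) : imp (box φ) (box ψ) ∈ D :=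
  hD.mp (hD.box_dist _ _) (hD.box_nec h)

/-- The rule of universal generalization in the consequent. -/
theorem imp_all (hD : IsLogic S D) {φ ψ : SForm L} (h : imp (φ.rename Nat.succ) ψ ∈ D) :
    imp φ (all ψ) ∈ D :=
  hD.imp_trans (hD.all_vacuous φ) (hD.mp (hD.all_dist _ _) (hD.gen h))

/-- Universal generalization over a fresh variable. -/
theorem imp_all_of_fresh (hD : IsLogic S D) (g : ℕ → ℕ) (ψ : SForm L) :
    ∃ N, ∀ v, N ≤ v → (∀ j, g j ≠ v) → ∀ φ : SForm L,
      imp (φ.rename g) (ψ.inst (Language.Term.var v)) ∈ D → imp (φ.rename g) (all ψ) ∈ D := by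
  obtain ⟨N, hN⟩ := ψ.exists_bound
  refine ⟨N, fun v hv hg φ h => hD.imp_all ?_⟩
  -- This substitution turns the fresh variable `v` into `0` and shifts all others. It undoes the
  -- instantiation of `ψ`, none of whose relevant variables is `v` because `N ≤ v`, and it merely
  -- shifts `φ.rename g`, since `v` is outside the range of `g`.
  have h' := hD.subst
    (fun j => Language.Term.var (if j = v then 0 else j + 1)) h
  have e₁ : ((φ.rename g).subst fun j => Language.Term.var (if j = v then 0 else j + 1)) =
      (φ.rename g).rename Nat.succ := by
    simp only [rename, subst_subst]
    congr 1
    funext j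
    simp [Language.Term.subst, hg j]
  have e₂ : ((ψ.inst (Language.Term.var v)).subst
      fun j => Language.Term.var (if j = v then 0 else j + 1)) = ψ := by
    rw [inst, subst_subst]
    refine (hN _ Language.Term.var fun j hj => ?_).trans (subst_var ψ)
    cases j with
    | zero => simp [consTerm, Language.Term.subst]
    | succ j => simp [consTerm, Language.Term.subst, show j ≠ v by omega]
  simp only [imp, SForm.subst] at h'
  rw [e₁, e₂] at h'
  exact h'

/-- The Barcan formula. -/
theorem barcan (hD : IsLogic .S5 D) (φ : SForm L) : imp (all (box φ)) (box (all φ)) ∈ D := by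
  have h₁ : imp ((all (box φ)).rename Nat.succ) (box φ) ∈ D := by
    have h := hD.all_inst ((box φ).subst (lift fun j => Language.Term.var (Nat.succ j)))
      (Language.Term.var 0)
    rw [subst_lift_inst] at h
    have e : consTerm (Language.Term.var 0) (fun j => Language.Term.var (Nat.succ j)) =
        (Language.Term.var : ℕ → L.Term ℕ) := by
      funext j
      cases j <;> rfl
    rw [e, subst_var] at h
    exact h
  -- Writing `◇` for `¬□¬`, axiom 5 gives `◇∀□φ → □φ`, and reflexivity gives `φ`. Generalizing
  -- yields `◇∀□φ → ∀φ`, and `∀□φ → □◇∀□φ` then finishes.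
  have h₂ : imp (neg (box (neg ((all (box φ)).rename Nat.succ)))) φ ∈ D := by
    have h : imp (neg (box φ)) (neg ((all (box φ)).rename Nat.succ)) ∈ D :=
      hD.of_valuations₁ h₁ fun V hV => by simp only [hV.imp, hV.neg]; tauto
    have h' := hD.imp_trans (hD.box_eucl rfl φ) (hD.imp_box h)
    exact hD.of_valuations₂ h' (hD.box_refl (by simp) φ) fun V hV => by
      simp only [hV.imp, hV.neg]; tauto
  have h₃ : imp (neg (box (neg (all (box φ))))) (all φ) ∈ D := hD.imp_all h₂
  have h₄ : imp (all (box φ)) (neg (box (neg (all (box φ))))) ∈ D :=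
    hD.of_valuations₁ (hD.box_refl (by simp) (neg (all (box φ)))) fun V hV => by
      simp only [hV.imp, hV.neg]; tauto
  exact hD.imp_trans h₄ (hD.imp_trans (hD.box_eucl rfl _) (hD.imp_box h₃))

end IsLogic

namespace IsTheory

theorem of_valuations₁ (hD : IsLogic S D) (hT : IsTheory D T) {φ ψ : SForm L} (h₁ : φ ∈ T)
    (h : ∀ V, IsValuation V → V φ → V ψ) : ψ ∈ T :=
  mem_of_valuations (fun h => hT.logic (hD.taut h)) hT.mp [φ] (by simpa using h₁)
    (by simpa using h)

theorem of_valuations₂ (hD : IsLogic S D) (hT : IsTheory D T) {φ₁ φ₂ ψ : SForm L}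
    (h₁ : φ₁ ∈ T) (h₂ : φ₂ ∈ T) (h : ∀ V, IsValuation V → V φ₁ → V φ₂ → V ψ) : ψ ∈ T :=
  mem_of_valuations (fun h => hT.logic (hD.taut h)) hT.mp [φ₁, φ₂] (by simpa using ⟨h₁, h₂⟩)
    (by simpa using h)

/-- The Henkin rule is applied to the implication itself. Shifting `φ` protects it from capture, so
instantiation gives it back unchanged. -/
theorem imp_all (hD : IsLogic S D) (hT : IsTheory D T) {φ ψ : SForm L}
    (h : ∀ v, imp φ (ψ.inst (Language.Term.var v)) ∈ T) : imp φ (all ψ) ∈ T := by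
  have h' : all (imp (φ.rename Nat.succ) ψ) ∈ T := by
    refine hT.henkin fun v => ?_
    have e : (φ.rename Nat.succ).inst (Language.Term.var v) = φ := by
      rw [rename, inst, subst_subst]
      exact subst_var φ
    change imp ((φ.rename Nat.succ).inst (Language.Term.var v))
      (ψ.inst (Language.Term.var v)) ∈ T
    rw [e]
    exact h v
  exact of_valuations₂ hD hT (hT.mp (hT.logic (hD.all_dist _ _)) h')
    (hT.logic (hD.all_vacuous φ)) fun V hV => by simp only [hV.imp]; tauto

/-- A theory which is closed under the Henkin rule is the intersection of the worlds above it. -/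
theorem exists_isWorld [Countable (SForm L)] (hD : IsLogic S D) (hT : IsTheory D T)
    {φ : SForm L} (hφ : φ ∉ T) : ∃ w, IsWorld D w ∧ T ⊆ w ∧ φ ∉ w := by
  classical
  obtain ⟨_⟩ := nonempty_encodable (SForm L)
  -- Forcing conditions are the formulas consistent with `T`; a larger condition is a stronger one.
  let P := { ψ : SForm L // neg ψ ∉ T }
  let _ : Preorder P :=
    { le := fun a b => imp b.1 a.1 ∈ T
      le_refl := fun a => hT.logic (hD.taut fun V hV => (hV.imp _ _).2 id)
      le_trans := fun a b c h h' => of_valuations₂ hD hT h h' fun V hV => by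
        simp only [hV.imp]; tauto }
  have le_def : ∀ a b : P, a ≤ b ↔ imp b.1 a.1 ∈ T := fun _ _ => Iff.rfl
  have dense₁ : ∀ ψ : SForm L, IsCofinal { a : P | imp a.1 ψ ∈ T ∨ imp a.1 (neg ψ) ∈ T } := by
    intro ψ a
    by_cases h : neg (and a.1 ψ) ∈ T
    · exact ⟨a, Or.inr (of_valuations₁ hD hT h fun V hV => by
        simp only [hV.imp, hV.neg, hV.and]; tauto), le_refl a⟩
    · exact ⟨⟨and a.1 ψ, h⟩, Or.inl (hT.logic (hD.taut fun V hV => by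
        simp only [hV.imp, hV.and]; tauto)), hT.logic (hD.taut fun V hV => by
        simp only [hV.imp, hV.and]; tauto)⟩
  -- Every condition either already implies `∀ψ` or can be strengthened to refute some instance. The
  -- strengthened condition is consistent by `hv` itself, because `imp` unfolds to the negated
  -- conjunction.
  have dense₂ : ∀ ψ : SForm L, IsCofinal { a : P | imp a.1 (all ψ) ∈ T ∨
      ∃ v, imp a.1 (neg (ψ.inst (Language.Term.var v))) ∈ T } := by
    intro ψ a
    by_cases h : ∀ v, imp a.1 (ψ.inst (Language.Term.var v)) ∈ T
    · exact ⟨a, Or.inl (imp_all hD hT h), le_refl a⟩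
    · obtain ⟨v, hv⟩ := not_forall.1 h
      exact ⟨⟨and a.1 (neg (ψ.inst (Language.Term.var v))), hv⟩,
        Or.inr ⟨v, hT.logic (hD.taut fun V hV => by simp only [hV.imp, hV.and]; tauto)⟩,
        hT.logic (hD.taut fun V hV => by simp only [hV.imp, hV.and]; tauto)⟩
  have hφ' : neg (neg φ) ∉ T := fun h => hφ (of_valuations₁ hD hT h fun V hV => by
    simp only [hV.neg]; tauto)
  -- An ideal containing `¬φ` and meeting these countably many cofinal sets. The world consists of
  -- all formulas implied, modulo `T`, by a member of the ideal.
  let I := Order.idealOfCofinals (⟨neg φ, hφ'⟩ : P)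
    (Sum.elim (fun ψ => ⟨_, dense₁ ψ⟩) fun ψ => ⟨_, dense₂ ψ⟩ : SForm L ⊕ SForm L → Order.Cofinal P)
  have consistent : ∀ ψ (a b : P), a ∈ I → b ∈ I → imp a.1 ψ ∈ T → imp b.1 (neg ψ) ∉ T := by
    intro ψ a b ha hb h h'
    obtain ⟨c, hc, hac, hbc⟩ := I.directed a ha b hb
    have h₁ := of_valuations₂ hD hT ((le_def a c).1 hac) h (ψ := imp c.1 ψ) fun V hV => by
      simp only [hV.imp]; tauto
    have h₂ := of_valuations₂ hD hT ((le_def b c).1 hbc) h' (ψ := imp c.1 (neg ψ)) fun V hV => by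
      simp only [hV.imp]; tauto
    exact c.2 (of_valuations₂ hD hT h₁ h₂ fun V hV => by simp only [hV.imp, hV.neg]; tauto)
  have start := Order.mem_idealOfCofinals (⟨neg φ, hφ'⟩ : P)
    (Sum.elim (fun ψ => ⟨_, dense₁ ψ⟩) fun ψ => ⟨_, dense₂ ψ⟩ : SForm L ⊕ SForm L → Order.Cofinal P)
  have meets := Order.cofinal_meets_idealOfCofinals (⟨neg φ, hφ'⟩ : P)
    (Sum.elim (fun ψ => ⟨_, dense₁ ψ⟩) fun ψ => ⟨_, dense₂ ψ⟩ : SForm L ⊕ SForm L → Order.Cofinal P)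
  have sub : ∀ ψ ∈ T, ∃ a ∈ I, imp a.1 ψ ∈ T := fun ψ hψ =>
    ⟨_, start, of_valuations₁ hD hT hψ fun V hV => by simp only [hV.imp]; tauto⟩
  have neg_iff : ∀ ψ, (∃ a ∈ I, imp a.1 (neg ψ) ∈ T) ↔ ¬ ∃ a ∈ I, imp a.1 ψ ∈ T := by
    intro ψ
    constructor
    · rintro ⟨b, hb, hb'⟩ ⟨a, ha, ha'⟩
      exact consistent ψ a b ha hb ha' hb'
    · intro h
      obtain ⟨a, ha | ha, ha'⟩ := meets (Sum.inl ψ)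
      · exact absurd ⟨a, ha', ha⟩ h
      · exact ⟨a, ha', ha⟩
  refine ⟨{ ψ | ∃ a ∈ I, imp a.1 ψ ∈ T }, ⟨⟨?_, neg_iff, fun ψ χ => ⟨?_, ?_⟩⟩, ?_, ?_⟩, sub, ?_⟩
  · exact sub _ (hT.logic (hD.taut fun V hV => hV.top))
  · rintro ⟨a, ha, ha'⟩
    exact ⟨⟨a, ha, of_valuations₁ hD hT ha' fun V hV => by simp only [hV.imp, hV.and]; tauto⟩,
      ⟨a, ha, of_valuations₁ hD hT ha' fun V hV => by simp only [hV.imp, hV.and]; tauto⟩⟩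
  · rintro ⟨⟨a, ha, ha'⟩, ⟨b, hb, hb'⟩⟩
    obtain ⟨c, hc, hac, hbc⟩ := I.directed a ha b hb
    have h₁ := of_valuations₂ hD hT ((le_def a c).1 hac) ha' (ψ := imp c.1 ψ) fun V hV => by
      simp only [hV.imp]; tauto
    have h₂ := of_valuations₂ hD hT ((le_def b c).1 hbc) hb' (ψ := imp c.1 χ) fun V hV => by
      simp only [hV.imp]; tauto
    exact ⟨c, hc, of_valuations₂ hD hT h₁ h₂ fun V hV => by
      simp only [hV.imp, hV.and]; tauto⟩
  · exact fun ψ hψ => sub ψ (hT.logic hψ)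
  · intro ψ h
    obtain ⟨a, ha | ⟨v, hv⟩, ha'⟩ := meets (Sum.inr ψ)
    · exact ⟨a, ha', ha⟩
    · exact absurd (h v) ((neg_iff _).1 ⟨a, ha', hv⟩)
  · exact (neg_iff φ).1 ⟨_, start, hT.logic (hD.taut fun V hV => (hV.imp _ _).2 id)⟩

end IsTheory

/-- The set of theorems of a logic is closed under the Henkin rule. -/
theorem IsLogic.isTheory (hD : IsLogic S D) : IsTheory D D where
  logic := subset_rfl
  mp := hD.mp
  henkin := by
    intro φ h
    obtain ⟨N, hN⟩ := hD.imp_all_of_fresh (2 * ·) φ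
    -- Being odd, `2 * N + 1` is outside the range of doubling, and it exceeds the bound `N`. The
    -- premise `top` has no variables, so any renaming leaves it unchanged.
    have h' := hN (2 * N + 1) (by omega) (fun j => by omega) top
      (hD.of_valuations₁ (h (2 * N + 1)) fun V hV => by simp only [hV.imp]; tauto)
    exact hD.mp h' (hD.taut fun V hV => hV.top)

namespace IsWorld

theorem mp (hw : IsWorld D w) {φ ψ : SForm L} (h : imp φ ψ ∈ w) (h' : φ ∈ w) : ψ ∈ w :=
  (hw.val.imp φ ψ).1 h h'

theorem mem_of_logic (hw : IsWorld D w) {φ ψ : SForm L} (h : imp φ ψ ∈ D) (h' : φ ∈ w) :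
    ψ ∈ w :=
  hw.mp (hw.logic h) h'

/-- Individuals of the canonical model are arbitrary terms, while the Henkin rule asks only for
variable instances; `all_inst` supplies the remaining ones. -/
theorem all_mem_iff (hD : IsLogic S D) (hw : IsWorld D w) (φ : SForm L) :
    all φ ∈ w ↔ ∀ t, φ.inst t ∈ w :=
  ⟨fun h t => hw.mem_of_logic (hD.all_inst φ t) h, fun h => hw.henkin fun _ => h _⟩

theorem box_and_mem (hD : IsLogic S D) (hw : IsWorld D w) {φ ψ : SForm L} (hφ : box φ ∈ w)
    (hψ : box ψ ∈ w) : box (and φ ψ) ∈ w := by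
  have h : imp φ (imp ψ (and φ ψ)) ∈ D := hD.taut fun V hV => by
    simp only [hV.imp, hV.and]; tauto
  exact hw.mp (hw.mem_of_logic (hD.box_dist _ _) (hw.mem_of_logic (hD.imp_box h) hφ)) hψ

/-- Existence of successors, with fresh variables for witnesses. -/
theorem exists_successor [Countable (SForm L)] (hD : IsLogic S D) (hw : IsWorld D w)
    {φ : SForm L} (hφ : box φ ∉ w) :
    ∃ w', IsWorld D w' ∧ (∀ ψ, box ψ ∈ w → ψ.rename (2 * ·) ∈ w') ∧ φ.rename (2 * ·) ∉ w' := by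
  -- The consequences of the renamed formulas necessary at `w`. A single premise suffices for each,
  -- because boxed formulas are closed under conjunction. Premises use only even variables, so an
  -- odd instance can be generalized.
  have hT : IsTheory D { χ | ∃ ψ, box ψ ∈ w ∧ imp (ψ.rename (2 * ·)) χ ∈ D } := by
    refine ⟨fun χ hχ => ⟨top, hw.logic (hD.box_nec (hD.taut fun V hV => hV.top)),
      hD.of_valuations₁ hχ fun V hV => by simp only [hV.imp]; tauto⟩, ?_, ?_⟩
    · rintro χ χ' ⟨ψ, hψ, h⟩ ⟨ψ', hψ', h'⟩
      refine ⟨and ψ ψ', hw.box_and_mem hD hψ hψ', hD.of_valuations₂ h h' fun V hV => ?_⟩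
      change _ → _ → V (imp (and (ψ.rename _) (ψ'.rename _)) χ')
      simp only [hV.imp, hV.and]
      tauto
    · intro χ h
      obtain ⟨N, hN⟩ := hD.imp_all_of_fresh (2 * ·) χ
      obtain ⟨ψ, hψ, hψ'⟩ := h (2 * N + 1)
      exact ⟨ψ, hψ, hN _ (by omega) (fun j => by omega) ψ hψ'⟩
  obtain ⟨w', hw', h, h'⟩ := hT.exists_isWorld hD (φ := φ.rename (2 * ·)) (by
    rintro ⟨ψ, hψ, h⟩
    -- Halving undoes the doubling, so `ψ → φ` would be a theorem and `□φ` would lie in `w`.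
    have h' := hD.subst (fun j => Language.Term.var (j / 2)) h
    have e : ∀ χ : SForm L, (χ.rename (2 * ·)).subst (fun j => Language.Term.var (j / 2)) = χ := by
      intro χ
      rw [rename, subst_subst]
      refine Eq.trans ?_ (subst_var χ)
      congr 1
      funext j
      simp [Language.Term.subst]
    simp only [imp, SForm.subst] at h'
    rw [e, e] at h'
    exact hφ (hw.mem_of_logic (hD.imp_box h') hψ))
  exact ⟨w', hw', fun ψ hψ => h ⟨ψ, hψ, hD.taut fun V hV => (hV.imp _ _).2 id⟩, h'⟩

/-- Existence of successors with the same individuals. -/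
theorem exists_successor_S5 [Countable (SForm L)] (hD : IsLogic .S5 D) (hw : IsWorld D w)
    {φ : SForm L} (hφ : box φ ∉ w) :
    ∃ w', IsWorld D w' ∧ (∀ ψ, box ψ ∈ w → ψ ∈ w') ∧ φ ∉ w' := by
  have hT : IsTheory D { χ | box χ ∈ w } :=
    ⟨fun χ hχ => hw.logic (hD.box_nec hχ),
      fun h h' => hw.mp (hw.mem_of_logic (hD.box_dist _ _) h) h',
      -- The Barcan formula makes the set of necessary formulas closed under the Henkin rule without
      -- any new variables.
      fun h => hw.mem_of_logic (hD.barcan _) (hw.henkin h)⟩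
  obtain ⟨w', hw', h, h'⟩ := hT.exists_isWorld hD hφ
  exact ⟨w', hw', fun ψ hψ => h hψ, h'⟩

end IsWorld

end Logics

end SForm

/-! ### Countability of static formulas over a countable language -/

namespace SForm

section Countability

variable {L : FirstOrder.Language.{u, v}}

/-- The nesting depth of connectives. -/
def depth : SForm L → ℕ
  | top => 0
  | rel _ _ => 0
  | neg φ => φ.depth + 1
  | and φ ψ => max φ.depth ψ.depth + 1
  | all φ => φ.depth + 1
  | box φ => φ.depth + 1

theorem countable_depth_lt [Countable (Σ n, L.Functions n)] [Countable (Σ n, L.Relations n)]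
    (d : ℕ) : { φ : SForm L | φ.depth < d }.Countable := by
  induction d with
  | zero => simp
  | succ d ih =>
    refine (((((Set.countable_singleton top).union (Set.countable_range
      fun a : Σ F : (Σ n, L.Relations n), Fin F.1 → L.Term ℕ => rel a.1.2 a.2)).union
      (ih.image neg)).union (ih.image2 ih and)).union ((ih.image all).union (ih.image box))).mono ?_
    intro φ hφ
    cases φ with
    | top => simp
    | rel F ts => exact Or.inl (Or.inl (Or.inl (Or.inr ⟨⟨⟨_, F⟩, ts⟩, rfl⟩)))
    | neg φ => exact Or.inl (Or.inl (Or.inr ⟨φ, Nat.lt_of_succ_lt_succ hφ, rfl⟩))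
    | and φ ψ =>
      have h := max_lt_iff.1 (Nat.lt_of_succ_lt_succ hφ)
      exact Or.inl (Or.inr ⟨φ, h.1, ψ, h.2, rfl⟩)
    | all φ => exact Or.inr (Or.inl ⟨φ, Nat.lt_of_succ_lt_succ hφ, rfl⟩)
    | box φ => exact Or.inr (Or.inr ⟨φ, Nat.lt_of_succ_lt_succ hφ, rfl⟩)

instance [Countable (Σ n, L.Functions n)] [Countable (Σ n, L.Relations n)] :
    Countable (SForm L) := by
  rw [← Set.countable_univ_iff]
  refine (Set.countable_iUnion fun d => countable_depth_lt (L := L) d).mono fun φ _ => ?_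
  exact Set.mem_iUnion.2 ⟨φ.depth + 1, Nat.lt_succ_self _⟩

end Countability

end SForm

/-! ### Sublanguages -/

section SubLanguage

variable {L : FirstOrder.Language.{u, v}}

/-- The sublanguage with given function and relation symbols. -/
def subLanguage (Fs : Set (Σ n, L.Functions n)) (Rs : Set (Σ n, L.Relations n)) :
    FirstOrder.Language.{u, v} where
  Functions n := { f : L.Functions n // (⟨n, f⟩ : Σ n, L.Functions n) ∈ Fs }
  Relations n := { F : L.Relations n // (⟨n, F⟩ : Σ n, L.Relations n) ∈ Rs }

/-- The inclusion of a sublanguage. -/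
def subLanguageHom (Fs : Set (Σ n, L.Functions n)) (Rs : Set (Σ n, L.Relations n)) :
    subLanguage Fs Rs →ᴸ L where
  onFunction := fun _ f => f.1
  onRelation := fun _ F => F.1

variable {Fs : Set (Σ n, L.Functions n)} {Rs : Set (Σ n, L.Relations n)}

theorem countable_functions_subLanguage (h : Fs.Countable) :
    Countable (Σ n, (subLanguage Fs Rs).Functions n) := by
  have := h.to_subtype
  refine Function.Injective.countable (β := Fs) (f := fun a => ⟨⟨a.1, a.2.1⟩, a.2.2⟩) ?_
  rintro ⟨n, f, hf⟩ ⟨m, g, hg⟩ h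
  cases Subtype.ext_iff.1 h
  rfl

theorem countable_relations_subLanguage (h : Rs.Countable) :
    Countable (Σ n, (subLanguage Fs Rs).Relations n) := by
  have := h.to_subtype
  refine Function.Injective.countable (β := Rs) (f := fun a => ⟨⟨a.1, a.2.1⟩, a.2.2⟩) ?_
  rintro ⟨n, f, hf⟩ ⟨m, g, hg⟩ h
  cases Subtype.ext_iff.1 h
  rfl

/-- Quantifying over all larger sublanguages lets the symbols of several subterms be pooled. -/
theorem exists_subLanguage_term {α : Type*} (t : L.Term α) :
    ∃ Fs : Set (Σ n, L.Functions n), Fs.Countable ∧ ∀ Fs' Rs', Fs ⊆ Fs' →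
      ∃ t₀ : (subLanguage Fs' Rs').Term α, (subLanguageHom Fs' Rs').onTerm t₀ = t := by
  induction t with
  | var a => exact ⟨∅, Set.countable_empty, fun _ _ _ => ⟨.var a, rfl⟩⟩
  | @func k f ts ih =>
    choose Fs hFs h using ih
    refine ⟨insert ⟨k, f⟩ (⋃ i, Fs i), (Set.countable_iUnion hFs).insert _,
      fun Fs' Rs' hF => ?_⟩
    choose t₀ ht₀ using fun i =>
      h i Fs' Rs' (((Set.subset_iUnion Fs i).trans (Set.subset_insert _ _)).trans hF)
    exact ⟨.func ⟨f, hF (Set.mem_insert _ _)⟩ t₀, congrArg (Language.Term.func f) (funext ht₀)⟩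

/-- A static formula is a formula of a countable sublanguage. -/
theorem SForm.exists_subLanguage (φ : SForm L) :
    ∃ (Fs : Set (Σ n, L.Functions n)) (Rs : Set (Σ n, L.Relations n)),
      Fs.Countable ∧ Rs.Countable ∧ ∀ Fs' Rs', Fs ⊆ Fs' → Rs ⊆ Rs' →
        ∃ φ₀ : SForm (subLanguage Fs' Rs'), ∀ (𝓔 : EventFrames.{s}) (n : ℕ)
          (σ : ℕ → L.Term (Fin n)), (φ₀.toForm (subLanguageHom Fs' Rs') σ : Formula L 𝓔 n) =
            φ.toForm (.id L) σ := by
  induction φ with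
  | top =>
    exact ⟨∅, ∅, Set.countable_empty, Set.countable_empty, fun _ _ _ _ => ⟨top, fun _ _ _ => rfl⟩⟩
  | @rel k F ts =>
    choose Fs hFs h using fun i => exists_subLanguage_term (ts i)
    refine ⟨⋃ i, Fs i, {⟨k, F⟩}, Set.countable_iUnion hFs, Set.countable_singleton _,
      fun Fs' Rs' hF hR => ?_⟩
    choose t₀ ht₀ using fun i => h i Fs' Rs' ((Set.subset_iUnion Fs i).trans hF)
    refine ⟨.rel ⟨F, hR rfl⟩ t₀, fun 𝓔 n σ => ?_⟩
    simp only [toForm, ht₀, Language.LHom.id_onTerm, id]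
    rfl
  | neg φ ih =>
    obtain ⟨Fs, Rs, hFs, hRs, h⟩ := ih
    refine ⟨Fs, Rs, hFs, hRs, fun Fs' Rs' hF hR => ?_⟩
    obtain ⟨φ₀, h₀⟩ := h Fs' Rs' hF hR
    exact ⟨neg φ₀, fun 𝓔 n σ => congrArg _ (h₀ 𝓔 n σ)⟩
  | and φ ψ ihφ ihψ =>
    obtain ⟨Fs₁, Rs₁, hFs₁, hRs₁, h₁⟩ := ihφ
    obtain ⟨Fs₂, Rs₂, hFs₂, hRs₂, h₂⟩ := ihψ
    refine ⟨Fs₁ ∪ Fs₂, Rs₁ ∪ Rs₂, hFs₁.union hFs₂, hRs₁.union hRs₂, fun Fs' Rs' hF hR => ?_⟩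
    rw [Set.union_subset_iff] at hF hR
    obtain ⟨φ₀, hφ₀⟩ := h₁ Fs' Rs' hF.1 hR.1
    obtain ⟨ψ₀, hψ₀⟩ := h₂ Fs' Rs' hF.2 hR.2
    exact ⟨and φ₀ ψ₀, fun 𝓔 n σ => congrArg₂ _ (hφ₀ 𝓔 n σ) (hψ₀ 𝓔 n σ)⟩
  | all φ ih =>
    obtain ⟨Fs, Rs, hFs, hRs, h⟩ := ih
    refine ⟨Fs, Rs, hFs, hRs, fun Fs' Rs' hF hR => ?_⟩
    obtain ⟨φ₀, h₀⟩ := h Fs' Rs' hF hR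
    exact ⟨all φ₀, fun 𝓔 n σ => congrArg _ (h₀ 𝓔 (n + 1) (liftCtx σ))⟩
  | box φ ih =>
    obtain ⟨Fs, Rs, hFs, hRs, h⟩ := ih
    refine ⟨Fs, Rs, hFs, hRs, fun Fs' Rs' hF hR => ?_⟩
    obtain ⟨φ₀, h₀⟩ := h Fs' Rs' hF hR
    exact ⟨box φ₀, fun 𝓔 n σ => congrArg _ (h₀ 𝓔 n σ)⟩

end SubLanguage

/-! ### Canonical models -/

section Canonical

variable {L : FirstOrder.Language.{u, v}} {Fs : Set (Σ n, L.Functions n)}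
  {Rs : Set (Σ n, L.Relations n)} (D : Set (SForm (subLanguage Fs Rs)))
  (A : ℕ → ℕ → Prop) (g : ℕ → ℕ → ℕ → ℕ)

/-- The worlds of the canonical model: complete theories with witnesses, each tagged with a level.
Along a transition from level `k` to level `l`, which requires `A k l`, variables are renamed
by `g k l`. -/
def canonicalWorlds : KripkeFrame.{max u v} where
  carrier := ℕ × { w : Set (SForm (subLanguage Fs Rs)) // SForm.IsWorld D w }
  rel x y := A x.1 y.1 ∧ ∀ ψ, SForm.box ψ ∈ x.2.1 → ψ.rename (g x.1 y.1) ∈ y.2.1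

/-- The individuals of the canonical model: terms of the sublanguage at a world. -/
def canonicalIndiv : KripkeFrame.{max u v} where
  carrier := canonicalWorlds D A g × (subLanguage Fs Rs).Term ℕ
  rel a b := (canonicalWorlds D A g).rel a.1 b.1 ∧ b.2 = a.2.relabel (g a.1.1 b.1.1)

open Classical in
/-- The application of a function symbol to terms of a sublanguage; symbols outside the sublanguage
denote the variable `0`. -/
noncomputable def applyTerm {n : ℕ} (f : L.Functions n) (ts : Fin n → (subLanguage Fs Rs).Term ℕ) :
    (subLanguage Fs Rs).Term ℕ :=
  if h : (⟨n, f⟩ : Σ n, L.Functions n) ∈ Fs then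
    Language.Term.func (L := subLanguage Fs Rs) ⟨f, h⟩ ts
  else Language.Term.var 0

/-- Function symbols are monotone in the canonical model because they commute with renaming. For
symbols outside the sublanguage, with value the variable `0`, this forces renamings to fix `0`. -/
theorem applyTerm_relabel {n : ℕ} (f : L.Functions n) (ts : Fin n → (subLanguage Fs Rs).Term ℕ)
    {h : ℕ → ℕ} (h0 : h 0 = 0) :
    (applyTerm f ts).relabel h = applyTerm f fun i => (ts i).relabel h := by
  unfold applyTerm
  split_ifs
  · rfl
  · simp [Language.Term.relabel, h0]

/-- The canonical model of a logic over a sublanguage. -/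
noncomputable def canonicalModel (g0 : ∀ k l, g k l 0 = 0) :
    KripkeSheafModel.{u, v, max u v} L where
  worlds := canonicalWorlds D A g
  indiv := canonicalIndiv D A g
  res := Prod.fst
  sheaf :=
    { bounded :=
        { mono := fun _ _ h => h.1
          back := fun a y h => ⟨(y, a.2.relabel (g a.1.1 y.1)), ⟨h, rfl⟩, rfl⟩ }
      unique := by
        rintro a ⟨x, t⟩ ⟨x', t'⟩ ⟨_, h⟩ ⟨_, h'⟩ e
        obtain rfl : x = x' := e
        exact Prod.ext rfl (h.trans h'.symm) }
  surj := fun x => ⟨(x, Language.Term.var 0), rfl⟩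
  funMap := fun f p => (p.1.1, applyTerm f fun i => (p.1.2 i).2)
  funMap_over := fun _ _ => rfl
  funMap_mono := by
    intro n f p q h
    refine ⟨h.1, ?_⟩
    change applyTerm f _ = (applyTerm f _).relabel _
    rw [applyTerm_relabel f _ (g0 _ _)]
    congr 1
    funext i
    have h' := (h.2 i).2
    rw [show (p.1.2 i).1 = p.1.1 from p.2 i, show (q.1.2 i).1 = q.1.1 from q.2 i] at h'
    exact h'
  relMap := fun {n} F => { p | ∃ h : (⟨n, F⟩ : Σ n, L.Relations n) ∈ Rs,
    SForm.rel (L := subLanguage Fs Rs) ⟨F, h⟩ (fun i => (p.1.2 i).2) ∈ p.1.1.2.1 }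

variable {D A g} {S : BaseLogic}

theorem termVal_canonicalModel (g0 : ∀ k l, g k l 0 = 0) {n : ℕ} (σ : ℕ → L.Term (Fin n))
    (p : (canonicalModel D A g g0).tuples n) (t : (subLanguage Fs Rs).Term ℕ) :
    ((canonicalModel D A g g0).termVal p (((subLanguageHom Fs Rs).onTerm t).subst σ)).1.2 =
      t.subst fun j => ((canonicalModel D A g g0).termVal p (σ j)).1.2 := by
  induction t with
  | var a => rfl
  | func f ts ih =>
    change applyTerm f.1 (fun i => ((canonicalModel D A g g0).termVal p _).1.2) = _
    simp only [ih]
    exact dif_pos f.2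

/-- The truth lemma. -/
theorem sat_toForm_canonicalModel {𝓔 : EventFrames.{s}} (hD : SForm.IsLogic S D)
    (g0 : ∀ k l, g k l 0 = 0)
    (hsucc : ∀ (x : canonicalWorlds D A g) (φ : SForm (subLanguage Fs Rs)),
      SForm.box φ ∉ x.2.1 →
        ∃ y, (canonicalWorlds D A g).rel x y ∧ φ.rename (g x.1 y.1) ∉ y.2.1)
    (φ : SForm (subLanguage Fs Rs)) : ∀ {n : ℕ} (σ : ℕ → L.Term (Fin n))
    (p : (canonicalModel D A g g0).tuples n),
    (φ.toForm (subLanguageHom Fs Rs) σ : Formula L 𝓔 n).sat (canonicalModel D A g g0) p ↔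
      φ.subst (fun j => ((canonicalModel D A g g0).termVal p (σ j)).1.2) ∈ p.1.1.2.1 := by
  induction φ with
  | top => exact fun σ p => iff_of_true trivial p.1.1.2.2.val.top
  | rel F ts =>
    intro n σ p
    simp only [SForm.subst, ← termVal_canonicalModel]
    exact ⟨fun h => h.2, fun h => ⟨F.2, h⟩⟩
  | neg φ ih => exact fun σ p => (not_congr (ih σ p)).trans (p.1.1.2.2.val.neg _).symm
  | and φ ψ ihφ ihψ =>
    exact fun σ p => (and_congr (ihφ σ p) (ihψ σ p)).trans (p.1.1.2.2.val.and _ _).symm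
  | all φ ih =>
    intro n σ p
    have key : ∀ (d : (canonicalModel D A g g0).indiv)
        (hd : (canonicalModel D A g g0).res d = p.1.1),
        (φ.toForm (subLanguageHom Fs Rs) (SForm.liftCtx σ) : Formula L 𝓔 (n + 1)).sat
          (canonicalModel D A g g0) ((canonicalModel D A g g0).extend p d hd) ↔
        (φ.subst (SForm.lift fun j => ((canonicalModel D A g g0).termVal p (σ j)).1.2)).inst d.2 ∈
          p.1.1.2.1 := by
      intro d hd
      rw [ih, SForm.subst_lift_inst]
      have e : (fun j => ((canonicalModel D A g g0).termVal
          ((canonicalModel D A g g0).extend p d hd) (SForm.liftCtx σ j)).1.2) =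
          consTerm d.2 fun j => ((canonicalModel D A g g0).termVal p (σ j)).1.2 := by
        funext j
        cases j with
        | zero =>
          exact congrArg Prod.snd
            (Fin.snoc_last (α := fun _ => (canonicalModel D A g g0).indiv.carrier) d p.1.2)
        | succ j =>
          exact congrArg Prod.snd
            ((canonicalModel D A g g0).termVal_relabel_castSucc_extend p d hd (σ j))
      rw [e]
      exact Iff.rfl
    refine Iff.trans ?_ (p.1.1.2.2.all_mem_iff hD _).symm
    exact ⟨fun h t => (key (p.1.1, t) rfl).1 (h (p.1.1, t) rfl),
      fun h d hd => (key d hd).2 (h d.2)⟩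
  | box φ ih =>
    intro n σ p
    have key : ∀ q : (canonicalModel D A g g0).tuples n,
        ((canonicalModel D A g g0).tuples n).rel p q →
        ((φ.toForm (subLanguageHom Fs Rs) σ : Formula L 𝓔 n).sat (canonicalModel D A g g0) q ↔
        (φ.subst fun j => ((canonicalModel D A g g0).termVal p (σ j)).1.2).rename
          (g p.1.1.1 q.1.1.1) ∈ q.1.1.2.1) := by
      intro q hq
      rw [ih, SForm.rename, SForm.subst_subst]
      have e : (fun j => ((canonicalModel D A g g0).termVal q (σ j)).1.2) =
          fun j => (((canonicalModel D A g g0).termVal p (σ j)).1.2).subst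
            fun j => Language.Term.var (g p.1.1.1 q.1.1.1 j) := by
        funext j
        -- Monotonicity of terms says exactly that the value at `q` is the renamed value at `p`.
        have h := ((canonicalModel D A g g0).termVal_mono hq (σ j)).2
        rw [show ((canonicalModel D A g g0).termVal p (σ j)).1.1 = p.1.1 from
          ((canonicalModel D A g g0).termVal p (σ j)).2,
          show ((canonicalModel D A g g0).termVal q (σ j)).1.1 = q.1.1 from
          ((canonicalModel D A g g0).termVal q (σ j)).2] at h
        exact h.trans (term_subst_var_comp _ _).symm
      rw [e]
    constructor
    · intro h
      by_contra hb
      obtain ⟨y, hy, hy'⟩ := hsucc p.1.1 _ hb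
      -- `hsucc` yields only a world; boundedness carries the tuple along to it.
      obtain ⟨q, hq, rfl⟩ := (canonicalModel D A g g0).exists_tuple_rel p y hy
      exact hy' ((key q hq).1 (h q hq))
    · exact fun h q hq => (key q hq).2 (hq.1.2 _ h)

end Canonical

/-! ### Completeness -/

/-! ### Renamings, successors and frame conditions in the canonical frames -/

section Frames

variable {L : FirstOrder.Language.{u, v}} {Fs : Set (Σ n, L.Functions n)}
  {Rs : Set (Σ n, L.Relations n)} {D : Set (SForm (subLanguage Fs Rs))}

theorem rename_rename (φ : SForm L) (g h : ℕ → ℕ) :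
    (φ.rename g).rename h = φ.rename fun j => h (g j) := by
  rw [SForm.rename, SForm.rename, SForm.subst_subst]
  rfl

theorem rename_id (φ : SForm L) : φ.rename (fun j => j) = φ :=
  SForm.subst_var φ

/-- The successor is placed one level up, where the renaming is exactly doubling. -/
theorem exists_successor_increasing [Countable (SForm (subLanguage Fs Rs))] {S : BaseLogic}
    (hD : SForm.IsLogic S D) (x : canonicalWorlds D (· ≤ ·) fun k l j => 2 ^ (l - k) * j)
    (φ : SForm (subLanguage Fs Rs)) (h : SForm.box φ ∉ x.2.1) :
    ∃ y, (canonicalWorlds D (· ≤ ·) fun k l j => 2 ^ (l - k) * j).rel x y ∧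
      φ.rename (fun j => 2 ^ (y.1 - x.1) * j) ∉ y.2.1 := by
  obtain ⟨w, hw, h₁, h₂⟩ := x.2.2.exists_successor hD h
  have e : (fun j : ℕ => 2 ^ (x.1 + 1 - x.1) * j) = (2 * ·) := by
    funext j
    simp
  refine ⟨(x.1 + 1, ⟨w, hw⟩), ⟨Nat.le_succ _, fun ψ hψ => ?_⟩, ?_⟩
  · change ψ.rename (fun j : ℕ => 2 ^ (x.1 + 1 - x.1) * j) ∈ w
    rw [e]
    exact h₁ ψ hψ
  · change φ.rename (fun j : ℕ => 2 ^ (x.1 + 1 - x.1) * j) ∉ w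
    rw [e]
    exact h₂

theorem frameCondition_increasing (hD : SForm.IsLogic .S4 D) :
    BaseLogic.S4.FrameCondition (canonicalWorlds D (· ≤ ·) fun k l j => 2 ^ (l - k) * j) ∧
      BaseLogic.S4.FrameCondition (canonicalIndiv D (· ≤ ·) fun k l j => 2 ^ (l - k) * j) := by
  have e₁ : ∀ k : ℕ, (fun j : ℕ => 2 ^ (k - k) * j) = fun j => j := by
    intro k
    funext j
    simp
  -- Renamings compose along levels. This is what makes both relations transitive, and it needs the
  -- levels to increase because subtraction is truncated.
  have e₂ : ∀ {k l m : ℕ}, k ≤ l → l ≤ m →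
      (fun j : ℕ => 2 ^ (m - l) * (2 ^ (l - k) * j)) = fun j => 2 ^ (m - k) * j := by
    intro k l m hkl hlm
    funext j
    rw [← mul_assoc, ← pow_add]
    congr 2
    omega
  have hX : BaseLogic.S4.FrameCondition
      (canonicalWorlds D (· ≤ ·) fun k l j => 2 ^ (l - k) * j) := by
    refine ⟨fun x => ⟨le_refl x.1, fun ψ hψ => ?_⟩, fun x y z h h' => ⟨le_trans h.1 h'.1,
      fun ψ hψ => ?_⟩⟩
    · change ψ.rename (fun j : ℕ => 2 ^ (x.1 - x.1) * j) ∈ _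
      rw [e₁, rename_id]
      exact x.2.2.mem_of_logic (hD.box_refl (by simp) ψ) hψ
    · have h₁ : (ψ.rename fun j => 2 ^ (y.1 - x.1) * j).rename (fun j => 2 ^ (z.1 - y.1) * j) ∈
          z.2.1 := h'.2 _ (h.2 _ (x.2.2.mem_of_logic (hD.box_trans (by simp) ψ) hψ))
      rw [rename_rename, e₂ h.1 h'.1] at h₁
      exact h₁
  refine ⟨hX, fun a => ⟨hX.1 _, ?_⟩, fun a b c h h' => ⟨hX.2 _ _ _ h.1 h'.1, ?_⟩⟩
  · change a.2 = a.2.relabel (fun j : ℕ => 2 ^ (a.1.1 - a.1.1) * j)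
    rw [e₁]
    exact (Language.Term.relabel_id a.2).symm
  · have h₁ := h'.2
    rw [h.2, Language.Term.relabel_relabel] at h₁
    exact h₁.trans (congrArg a.2.relabel (e₂ h.1.1 h'.1.1))

theorem exists_successor_constant [Countable (SForm (subLanguage Fs Rs))]
    (hD : SForm.IsLogic .S5 D) (x : canonicalWorlds D (fun _ _ => True) fun _ _ j => j)
    (φ : SForm (subLanguage Fs Rs)) (h : SForm.box φ ∉ x.2.1) :
    ∃ y, (canonicalWorlds D (fun _ _ => True) fun _ _ j => j).rel x y ∧
      φ.rename (fun j => j) ∉ y.2.1 := by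
  obtain ⟨w, hw, h₁, h₂⟩ := x.2.2.exists_successor_S5 hD h
  refine ⟨(0, ⟨w, hw⟩), ⟨trivial, fun ψ hψ => ?_⟩, ?_⟩
  · rw [rename_id]
    exact h₁ ψ hψ
  · rw [rename_id]
    exact h₂

theorem frameCondition_constant (hD : SForm.IsLogic .S5 D) :
    BaseLogic.S5.FrameCondition (canonicalWorlds D (fun _ _ => True) fun _ _ j => j) ∧
      BaseLogic.S5.FrameCondition (canonicalIndiv D (fun _ _ => True) fun _ _ j => j) := by
  have hX : BaseLogic.S5.FrameCondition
      (canonicalWorlds D (fun _ _ => True) fun _ _ j => j) := by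
    refine ⟨fun x => ⟨trivial, fun ψ hψ => ?_⟩, fun {x y} h => ⟨trivial, fun ψ hψ => ?_⟩,
      fun {x y z} h h' => ⟨trivial, fun ψ hψ => ?_⟩⟩
    · rw [rename_id]
      exact x.2.2.mem_of_logic (hD.box_refl (by simp) ψ) hψ
    · rw [rename_id]
      by_contra hb
      -- Symmetry: if `ψ` fails at `x`, so does `□ψ`, and axiom 5 transports `¬□ψ` to `y`,
      -- contradicting `□ψ` there.
      have hb' : SForm.box ψ ∉ x.2.1 := fun h' =>
        hb (x.2.2.mem_of_logic (hD.box_refl (by simp) ψ) h')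
      have h₁ := h.2 _ (x.2.2.mem_of_logic (hD.box_eucl rfl ψ) ((x.2.2.val.neg _).2 hb'))
      rw [rename_id] at h₁
      exact (y.2.2.val.neg _).1 h₁ hψ
    · have h₁ := h'.2 _ (h.2 _ (x.2.2.mem_of_logic (hD.box_trans (by simp) ψ) hψ))
      rw [rename_id] at h₁
      exact h₁
  refine ⟨hX, fun a => ⟨hX.refl _, (Language.Term.relabel_id a.2).symm⟩,
    fun {a b} h => ⟨hX.symm h.1, ?_⟩, fun {a b c} h h' => ⟨hX.trans h.1 h'.1, ?_⟩⟩
  · have h₁ : b.2 = a.2 := h.2.trans (Language.Term.relabel_id a.2)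
    exact h₁.symm.trans (Language.Term.relabel_id b.2).symm
  · have h₁ : b.2 = a.2 := h.2.trans (Language.Term.relabel_id a.2)
    have h₂ := h'.2
    rw [h₁] at h₂
    exact h₂

/-- A canonical model of the class that corresponds to the base logic, in which successors
exist. -/
theorem exists_canonical [Countable (SForm (subLanguage Fs Rs))] {S : BaseLogic}
    (hD : SForm.IsLogic S D) :
    ∃ (A : ℕ → ℕ → Prop) (g : ℕ → ℕ → ℕ → ℕ), (∀ k l, g k l 0 = 0) ∧
      S.FrameCondition (canonicalWorlds D A g) ∧ S.FrameCondition (canonicalIndiv D A g) ∧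
      ∀ (x : canonicalWorlds D A g) (φ : SForm (subLanguage Fs Rs)), SForm.box φ ∉ x.2.1 →
        ∃ y, (canonicalWorlds D A g).rel x y ∧ φ.rename (g x.1 y.1) ∉ y.2.1 := by
  cases S with
  | K =>
    exact ⟨(· ≤ ·), fun k l j => 2 ^ (l - k) * j, fun _ _ => rfl, trivial, trivial,
      exists_successor_increasing hD⟩
  | S4 =>
    obtain ⟨hX, hI⟩ := frameCondition_increasing hD
    exact ⟨(· ≤ ·), fun k l j => 2 ^ (l - k) * j, fun _ _ => rfl, hX, hI,
      exists_successor_increasing hD⟩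
  | S5 =>
    obtain ⟨hX, hI⟩ := frameCondition_constant hD
    exact ⟨fun _ _ => True, fun _ _ j => j, fun _ _ => rfl, hX, hI, exists_successor_constant hD⟩

end Frames

/-! ### From unprovability to a countermodel -/

section Completeness

variable {S : BaseLogic} {L : FirstOrder.Language.{u, v}} {𝓔 : EventFrames.{s}}

/-- The static formulas all of whose translations are provable. -/
def derivable (S : BaseLogic) (𝓔 : EventFrames.{s}) {L₀ : FirstOrder.Language.{u', v'}}
    (ι : L₀ →ᴸ L) : Set (SForm L₀) :=
  { φ | ∀ (n : ℕ) (σ : ℕ → L.Term (Fin n)), Provable S (φ.toForm ι σ : Formula L 𝓔 n) }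

/-- Each closure property holds context by context. Quantifying over all `n` and `σ` is what makes
the set closed under substitution and generalization. -/
theorem isLogic_derivable {L₀ : FirstOrder.Language.{u', v'}} (ι : L₀ →ᴸ L) :
    SForm.IsLogic S (derivable S 𝓔 ι) where
  taut h n σ := .taut fun V h₁ h₂ h₃ =>
    h (fun ψ => V (ψ.toForm ι σ)) ⟨h₁, fun _ => h₂ _, fun _ _ => h₃ _ _⟩
  mp h h' n σ := .mp (h n σ) (h' n σ)
  subst s h n σ := by
    rw [SForm.toForm_subst]
    exact h n _
  all_inst φ t n σ := by
    rw [SForm.toForm_imp, SForm.toForm_inst]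
    exact .all_inst _ _
  all_dist φ ψ n σ := .all_dist _ _
  all_vacuous φ n σ := by
    have h := (Provable.all_vacuous (S := S) (φ.toForm ι σ : Formula L 𝓔 n)).iff_right
    rw [← SForm.toForm_rename_succ] at h
    exact h
  gen h n σ := .gen (h _ _)
  box_dist φ ψ n σ := .box_dist _ _
  box_nec h n σ := .box_nec (h n σ)
  box_refl hS φ n σ := by
    cases S with
    | K => exact absurd rfl hS
    | S4 => exact .base (.refl_S4 _)
    | S5 => exact .base (.refl_S5 _)
  box_trans hS φ n σ := by
    cases S with
    | K => exact absurd rfl hS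
    | S4 => exact .base (.trans_S4 _)
    | S5 => exact .base (.trans_S5 _)
  box_eucl hS φ n σ := by
    subst hS
    exact .base (.eucl_S5 _)

theorem Provable.of_weaken {n : ℕ} {φ : Formula L 𝓔 n} (h : Provable S φ.weaken) :
    Provable S φ :=
  .mp (all_vacuous φ).iff_left (.gen h)

/-- Completeness. -/
theorem Valid.provable (h𝓔 : ∀ i, S.FrameCondition (𝓔.frame i)) {n : ℕ} {φ : Formula L 𝓔 n}
    (h : Valid.{u, v, s, max u v} S φ) : Provable S φ := by
  obtain ⟨Fs, Rs, hFs, hRs, H⟩ :=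
    SForm.exists_subLanguage.{u, v, s} (φ.reduce fun i : Fin n => (i : ℕ))
  obtain ⟨χ, hχ⟩ := H Fs Rs subset_rfl subset_rfl
  have := countable_functions_subLanguage (Rs := Rs) hFs
  have := countable_relations_subLanguage (Fs := Fs) hRs
  have hD : SForm.IsLogic S (derivable S 𝓔 (subLanguageHom Fs Rs)) := isLogic_derivable _
  -- The empty context may have no terms, so one dummy variable is added. Variables from `n` on are
  -- all sent to it; `Provable.of_weaken` removes it at the end.
  let r : ℕ → Fin (n + 1) := fun j => ⟨min j n, Nat.lt_succ_of_le (min_le_right j n)⟩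
  let σ : ℕ → L.Term (Fin (n + 1)) := fun j => .var (r j)
  have hred : Provable S (Formula.iff φ.weaken (χ.toForm (subLanguageHom Fs Rs) σ)) := by
    rw [hχ]
    convert provable_subst_iff_reduce (S := S) φ (fun i : Fin n => (i : ℕ)) σ using 2
    unfold Formula.weaken
    congr 1
    funext i
    exact congrArg _ (Fin.ext (min_eq_left i.2.le).symm)
  -- The truth lemma at the tuple `p` below speaks of `χ` with its variables collapsed by `r`, so
  -- that formula is the one to refute. Since `r` is idempotent, collapsing does not change the
  -- translation along `σ`.
  have hσ : χ.subst (fun j => .var (r j)) ∈ derivable S 𝓔 (subLanguageHom Fs Rs) →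
      Provable S φ := by
    intro hd
    have h₁ := hd (n + 1) σ
    rw [SForm.toForm_subst] at h₁
    have e : (fun j => ((subLanguageHom Fs Rs).onTerm
        (Language.Term.var (r j : ℕ) : (subLanguage Fs Rs).Term ℕ)).subst σ) = σ := by
      funext j
      exact congrArg Language.Term.var (Fin.ext (by simp [r]))
    rw [e] at h₁
    exact .of_weaken (.mp hred.iff_right h₁)
  by_contra hn
  obtain ⟨w, hw, -, hw'⟩ := hD.isTheory.exists_isWorld hD fun h => hn (hσ h)
  obtain ⟨A, g, g0, hX, hI, hsucc⟩ := exists_canonical hD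
  let M := canonicalModel (derivable S 𝓔 (subLanguageHom Fs Rs)) A g g0
  let x : M.worlds := (0, ⟨w, hw⟩)
  let p : M.tuples (n + 1) := ⟨(x, fun i => (x, .var (i : ℕ))), fun _ => rfl⟩
  have h₁ : φ.weaken.sat M p := (φ.sat_subst _ M p).2 (h M hX hI _)
  -- Soundness transfers truth from `φ` to its static form, so reduction needs no separate semantic
  -- analysis.
  have h₂ := ((Formula.sat_iff _ _ M p).1 (hred.valid h𝓔 M hX hI p)).1 h₁
  exact hw' ((sat_toForm_canonicalModel hD g0 hsucc χ σ p).1 h₂)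

end Completeness

end FODEL

/-- Soundness holds for models in any universe; completeness needs validity only in the universe of
the canonical model, whose worlds are sets of static formulas. -/
theorem mainTheorem1 (S : FODEL.BaseLogic) (L : FirstOrder.Language.{u, v})
    (𝓔 : FODEL.EventFrames.{s}) (h𝓔 : ∀ i, S.FrameCondition (𝓔.frame i))
    {n : ℕ} (φ : FODEL.Formula L 𝓔 n) :
    (FODEL.Provable S φ → FODEL.Valid.{u, v, s, w} S φ) ∧
      (FODEL.Valid.{u, v, s, max u v} S φ → FODEL.Provable S φ) :=
  ⟨fun h => h.valid h𝓔, fun h => h.provable h𝓔⟩
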